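/- Let $\Omega=[0,W]\times[0,H]\subset\mathbb R^2$ with $W,H>0$ be the image domain and let $M$ be a multi-class mask, assigning a label to every point of $\Omega$. The label-transition boundary of $M$ is the set of points of $\Omega$ arbitrarily close to which $M$ takes two different labels in $\Omega$. Let $G=(V,E)$ be a (finite) planar straight-line graph in $\mathbb R^2$ with $V\subset\Omega$, not necessarily connected, whose embedding includes the image boundary $\partial\Omega$ and contains the whole label-transition boundary of $M$. The faces of $G$ are the connected components of $\Omega\setminus G$; on each of them $M$ is constant, and this constant is the label of the face. Suppose that (i) every edge not contained in $\partial\Omega$ lies on the label-transition boundary of $M$, and the faces on its two sides have distinct labels; (ii) every vertex is a geometric keypoint: a junction (at least three edges meet), a corner (exactly two edges meet, and they are not collinear), or an endpoint (exactly one edge). For each face $F$, trace its boundary: walk along the directed edges that have $F$ on their left, continuing at each vertex with the edge that comes first when the edge just traversed is turned clockwise about that vertex. Give the polygon formed by the resulting closed rings the label of $F$; its inside is the set of points not on the rings about which the rings have nonzero total winding number, and its region is the inside together with the rings. Then the inside of the polygon traced for $F$ is exactly $F$, the sides of all these polygons are exactly the edges of $G$, and the labelled polygons form an all-class planar partition of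 $\Omega$, that is: (a) there are finitely many polygons and each is a valid polygon, possibly with holes: its rings are closed, no edge is used twice (in the same or in opposite directions), sides meet only in common endpoints, and cutting the rings at the vertices where they touch themselves yields simple closed polygonal rings, exactly one of which is a counterclockwise outer ring while all others are clockwise rings of holes; the total winding number is $1$ inside and $0$ outside; the inside is nonempty, open, connected and bounded, and its frontier is the union of the sides; (b) no gaps: the union of the regions of the polygons is $\Omega$; (c) no overlaps: the regions of distinct polygons have disjoint interiors; (d) consistent labels: everywhere inside a polygon, $M$ equals the label of the polygon; (e) consistent shared edges: any two sides of polygons are equal up to direction or meet only in common endpoints; no directed side belongs to two polygons; a side contained in $\partial\Omega$ belongs to one polygon only; every other side is shared with exactly one other polygon, which traverses it in the opposite direction and has a different label; (f) no redundant or dangling vertices: at each vertex of a polygon either at least three edges meet, or exactly two edges meet and they are not collinear. -/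

import Mathlib

open scoped Topology ComplexConjugate

noncomputable section

namespace ACPV

/-! The plane `ℝ²` is `ℂ` with its Euclidean metric. A directed segment is a pair `(a, b) : ℂ × ℂ`. -/

/-! ### Polygons given by rings -/

/-- A ring: a cyclic list of directed segments. -/
abbrev Ring := Cycle (ℂ × ℂ)

/-- The points lying on the segments of a ring. -/
def Ring.boundary (c : Ring) : Set ℂ := ⋃ s ∈ c, segment ℝ s.1 s.2

/-- The winding number of a ring around `p`: the sum of the signed angles under which the
segments are seen from `p`, divided by `2π`. -/
def Ring.winding (c : Ring) (p : ℂ) : ℝ :=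
  (c.toMultiset.map fun s => Complex.arg ((s.2 - p) / (s.1 - p))).sum / (2 * Real.pi)

/-- Each segment of the ring ends where the next one (cyclically) starts. -/
def Ring.Closed (c : Ring) : Prop := Cycle.Chain (fun s t : ℂ × ℂ => s.2 = t.1) c

/-- Two directed segments meet properly: they agree up to direction, or they have no common
point apart from common endpoints. -/
def ProperlyMeet (s t : ℂ × ℂ) : Prop :=
  s = t ∨ s = t.swap ∨
    (segment ℝ s.1 s.2 ∩ segment ℝ t.1 t.2 ⊆ {s.1, s.2} ∩ {t.1, t.2})

/-- The ring runs once around a simple polygon: it is closed, has at least three sides and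
pairwise distinct corners, and distinct sides meet only in common endpoints. -/
structure Ring.Simple (c : Ring) : Prop where
  closed : Ring.Closed c
  three_le : 3 ≤ c.length
  nodup : (c.map Prod.fst).Nodup
  proper : ∀ s ∈ c, ∀ t ∈ c, ProperlyMeet s t

/-- A simple ring traversed counterclockwise (an outer ring). -/
def Ring.IsOuter (c : Ring) : Prop :=
  Ring.Simple c ∧ ∀ p ∉ Ring.boundary c, Ring.winding c p = 0 ∨ Ring.winding c p = 1

/-- A simple ring traversed clockwise (the ring of a hole). -/
def Ring.IsHole (c : Ring) : Prop :=
  Ring.Simple c ∧ ∀ p ∉ Ring.boundary c, Ring.winding c p = 0 ∨ Ring.winding c p = -1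

/-- A polygon, possibly with holes, given by finitely many rings, and carrying a label. -/
structure LabelledPolygon (C : Type*) where
  rings : Finset Ring
  label : C

namespace LabelledPolygon

variable {C : Type*} (P : LabelledPolygon C)

/-- The directed sides of the polygon, with multiplicity. -/
def sides : Multiset (ℂ × ℂ) := ∑ r ∈ P.rings, r.toMultiset

/-- The points on the sides of the polygon. -/
def boundary : Set ℂ := ⋃ s ∈ P.sides, segment ℝ s.1 s.2

/-- The total winding number of the rings around `p`. -/
def winding (p : ℂ) : ℝ := ∑ r ∈ P.rings, Ring.winding r p

/-- The points enclosed by the rings (nonzero winding number). -/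
def inside : Set ℂ := {p | p ∉ P.boundary ∧ P.winding p ≠ 0}

/-- The closed region covered by the polygon. -/
def region : Set ℂ := P.boundary ∪ P.inside

/-- Validity of a polygon with holes. Every ring is closed, no side is used twice, in the same
or in opposite directions; the sides meet only in common endpoints; cutting the rings at the
vertices at which they touch themselves gives simple rings, exactly one of which is
an outer ring while all others are rings of holes; the polygon lies to the left of its rings
(winding number `1` inside and `0` outside), and its inside is nonempty, open, connected, bounded,
with frontier the union of the sides. -/
structure Valid : Prop where
  closed : ∀ r ∈ P.rings, Ring.Closed r ∧ 3 ≤ r.length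
  nodup : P.sides.Nodup
  not_both : ∀ s ∈ P.sides, s.1 ≠ s.2 ∧ s.swap ∉ P.sides
  proper : ∀ s ∈ P.sides, ∀ t ∈ P.sides, ProperlyMeet s t
  outer_holes : ∃ (parts : Ring → Multiset Ring) (outer : Ring) (holes : Multiset Ring),
    (∀ r ∈ P.rings, ((parts r).map Cycle.toMultiset).sum = r.toMultiset) ∧
    ∑ r ∈ P.rings, parts r = outer ::ₘ holes ∧
    Ring.IsOuter outer ∧ ∀ h ∈ holes, Ring.IsHole h
  winding_eq : ∀ p ∉ P.boundary, P.winding p = 0 ∨ P.winding p = 1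
  isOpen : IsOpen P.inside
  connected : IsConnected P.inside
  bounded : Bornology.IsBounded P.inside
  frontier_eq : frontier P.inside = P.boundary

end LabelledPolygon

/-! ### Keypoints -/

/-- `v`, joined to the points of `N`, is a junction. -/
def IsJunction (_v : ℂ) (N : Set ℂ) : Prop := 3 ≤ N.ncard

/-- `v`, joined to the points of `N`, is a corner: exactly two edges meet at `v`, and they do not
lie on a common line. -/
def IsCorner (v : ℂ) (N : Set ℂ) : Prop :=
  ∃ a b, a ≠ b ∧ N = {a, b} ∧ ¬ Collinear ℝ {a, v, b}

/-- `v`, joined to the points of `N`, is an endpoint of a chain of edges. -/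
def IsEndpoint (_v : ℂ) (N : Set ℂ) : Prop := N.ncard = 1

/-! ### The constraints on an all-class polygonal partition -/

/-- The labelled polygons `P i` form an all-class polygonal partition of the domain `Ω` compatible
with the mask `M`. -/
structure IsPartition {C ι : Type*} (Ω : Set ℂ) (M : ℂ → C)
    (P : ι → LabelledPolygon C) : Prop where
  /-- (a) finitely many polygons, all valid -/
  valid : Finite ι ∧ ∀ i, (P i).Valid
  /-- (b) no gaps -/
  no_gaps : ⋃ i, (P i).region = Ω
  /-- (c) no overlaps -/
  no_overlaps : ∀ i j, i ≠ j → Disjoint (interior (P i).region) (interior (P j).region)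
  /-- (d) the label of a polygon is the label of the mask everywhere inside the polygon -/
  labels : ∀ i, ∀ p ∈ (P i).inside, M p = (P i).label
  /-- (e) consistent shared edges: sides of any two polygons are equal up to direction or
  meet only in common endpoints; no directed side is used by two polygons; a side on the boundary
  of the domain belongs to one polygon only, and any other side is shared with exactly one other
  polygon, which traverses it in the opposite direction and has a different label -/
  shared : (∀ i j, ∀ s ∈ (P i).sides, ∀ t ∈ (P j).sides, ProperlyMeet s t) ∧
    (∀ i j, i ≠ j → ∀ s ∈ (P i).sides, s ∉ (P j).sides) ∧
    (∀ i, ∀ s ∈ (P i).sides, segment ℝ s.1 s.2 ⊆ frontier Ω → ∀ j, s.swap ∉ (P j).sides) ∧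
    (∀ i, ∀ s ∈ (P i).sides, ¬ segment ℝ s.1 s.2 ⊆ frontier Ω →
      ∃ j, j ≠ i ∧ s.swap ∈ (P j).sides ∧ (P j).label ≠ (P i).label ∧
        ∀ k, s.swap ∈ (P k).sides → k = j)
  /-- (f) no redundant or dangling vertices: at every vertex either at least three edges meet, or
  exactly two, which form a proper corner -/
  no_redundant : ∀ i, ∀ s ∈ (P i).sides,
    IsJunction s.1 {w | ∃ j, (s.1, w) ∈ (P j).sides ∨ (w, s.1) ∈ (P j).sides} ∨
    IsCorner s.1 {w | ∃ j, (s.1, w) ∈ (P j).sides ∨ (w, s.1) ∈ (P j).sides}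

/-! ### Planar straight-line graphs -/

/-- A planar straight-line graph: finitely many points of the plane, some pairs of which are joined
by straight edges that contain no further vertex and do not cross. -/
structure PSLG where
  verts : Finset ℂ
  graph : SimpleGraph ℂ
  mem_verts : ∀ u v, graph.Adj u v → u ∈ verts
  vertex_notMem : ∀ u v w, graph.Adj u v → w ∈ verts → w ∉ openSegment ℝ u v
  disjoint_edges : ∀ u v w x, graph.Adj u v → graph.Adj w x → s(u, v) ≠ s(w, x) →
    Disjoint (openSegment ℝ u v) (openSegment ℝ w x)

namespace PSLG

variable (G : PSLG)

/-- The points on the vertices and edges of the graph. -/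
def support : Set ℂ := (G.verts : Set ℂ) ∪ ⋃ (u : ℂ) (v : ℂ) (_ : G.graph.Adj u v), segment ℝ u v

theorem neighborSet_finite (v : ℂ) : (G.graph.neighborSet v).Finite :=
  G.verts.finite_toSet.subset fun w hw =>
    G.mem_verts w v ((G.graph.mem_neighborSet v w).1 hw).symm

instance : Finite G.graph.Dart :=
  Finite.of_injective
    (fun d : G.graph.Dart =>
      ((⟨d.fst, G.mem_verts _ _ d.adj⟩, ⟨d.snd, G.mem_verts _ _ d.adj.symm⟩) :
        G.verts × G.verts))
    (by
      intro d e h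
      have h1 : d.fst = e.fst := congrArg (fun x => (x.1 : ℂ)) h
      have h2 : d.snd = e.snd := congrArg (fun x => (x.2 : ℂ)) h
      exact SimpleGraph.Dart.ext _ _ (Prod.ext h1 h2))

instance : Fintype G.graph.Dart := Fintype.ofFinite _

/-- The angle in `(0, 2π]` by which the direction `a` has to be turned clockwise to reach the
direction `b`. -/
def cwAngle (a b : ℂ) : ℝ := toIocMod Real.two_pi_pos 0 (Complex.arg (a / b))

theorem exists_next (d : G.graph.Dart) :
    ∃ w, G.graph.Adj d.snd w ∧ ∀ x, G.graph.Adj d.snd x →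
      cwAngle (d.fst - d.snd) (w - d.snd) ≤ cwAngle (d.fst - d.snd) (x - d.snd) := by
  obtain ⟨w, hw, h⟩ := Set.exists_min_image (G.graph.neighborSet d.snd)
    (fun w => cwAngle (d.fst - d.snd) (w - d.snd)) (G.neighborSet_finite d.snd)
    ⟨d.fst, d.adj.symm⟩
  exact ⟨w, hw, fun x hx => h x hx⟩

/-- One step of the tracing of a face that lies to the left: having walked along the directed
edge `u → v`, continue along the edge `v → w` that comes first when the edge from `v` back to `u`
is turned clockwise around `v`. -/
def next (d : G.graph.Dart) : G.graph.Dart :=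
  ⟨(d.snd, Classical.choose (G.exists_next d)), (Classical.choose_spec (G.exists_next d)).1⟩

/-- The ring traced from the directed edge `d`. -/
def tracedRing (d : G.graph.Dart) : Ring :=
  (Function.periodicOrbit G.next d).map fun e => (e.fst, e.snd)

/-- The faces of the graph in the domain `Ω`: the connected components of `Ω` minus the graph. -/
def Face (Ω : Set ℂ) : Type :=
  {F : Set ℂ // ∃ x ∈ Ω \ G.support, F = connectedComponentIn (Ω \ G.support) x}

variable {G} {Ω : Set ℂ}

theorem Face.nonempty (F : G.Face Ω) : F.1.Nonempty := by
  obtain ⟨x, hx, h⟩ := F.2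
  exact ⟨x, h ▸ mem_connectedComponentIn hx⟩

/-- The label that the mask gives to a face (the label of a point of the face; it depends on the
choice of this point only if the mask is not constant on the face). -/
def Face.label {C : Type*} (M : ℂ → C) (F : G.Face Ω) : C := M F.nonempty.some

/-- The face lies on the left of the directed edge from `u` to `v`. -/
def Face.IsLeftOf (F : G.Face Ω) (u v : ℂ) : Prop :=
  ∀ p ∈ openSegment ℝ u v, ∀ᶠ t : ℝ in 𝓝[>] 0, p + t * (Complex.I * (v - u)) ∈ F.1

open Classical in
/-- The labelled polygon obtained by tracing the boundary of a face from all directed edges that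
have the face on their left, and by taking the label of the face from the mask. -/
def Face.traced {C : Type*} (M : ℂ → C) (F : G.Face Ω) : LabelledPolygon C where
  rings := {d : G.graph.Dart | F.IsLeftOf d.fst d.snd}.toFinset.image G.tracedRing
  label := F.label M

end PSLG

/-! ### The image domain and the mask -/

/-- The image domain: a closed `W × H` rectangle. -/
def imageDomain (W H : ℝ) : Set ℂ := Set.Icc 0 W ×ℂ Set.Icc 0 H

/-- The label-transition boundary of the mask `M` in `Ω`: the points of `Ω` arbitrarily close to
which `M` takes two different labels in `Ω`. -/
def transitionSet {C : Type*} (Ω : Set ℂ) (M : ℂ → C) : Set ℂ :=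
  {x ∈ Ω | ∀ U ∈ 𝓝 x, ∃ y ∈ U ∩ Ω, ∃ z ∈ U ∩ Ω, M y ≠ M z}

/-- Condition (i): every edge, apart from those on the boundary of the domain, lies on the
label-transition boundary, and the faces on its two sides have distinct labels. -/
def EdgesSeparateLabels {C : Type*} (G : PSLG) (Ω : Set ℂ) (M : ℂ → C) : Prop :=
  ∀ u v, G.graph.Adj u v → ¬ segment ℝ u v ⊆ frontier Ω →
    segment ℝ u v ⊆ transitionSet Ω M ∧
    ∀ F F' : G.Face Ω, F.IsLeftOf u v → F'.IsLeftOf v u → F.label M ≠ F'.label M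

/-- Condition (ii): every vertex is a junction, a corner, or an endpoint. -/
def VertsAreKeypoints (G : PSLG) : Prop :=
  ∀ v ∈ G.verts, IsJunction v (G.graph.neighborSet v) ∨ IsCorner v (G.graph.neighborSet v) ∨
    IsEndpoint v (G.graph.neighborSet v)

end ACPV

end

/-!
The boundary of a face is controlled by winding numbers and by connectedness alone; no form of the
Jordan curve theorem is used.

*Faces and edges.* Near an inner point of an edge the graph is just a segment, so that the points
on either side form half-discs that avoid the graph. As a face is connected and its frontier lies
in the graph, a connected set that avoids the graph and meets a face lies in the face. Hence a
face that touches an edge from the left at one point does so everywhere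
(`IsRegion.leftOf_of_frequently`), and the frontier of a face is the union of the edges along it
(`IsRegion.frontier_eq`). Between an edge and its successor in the tracing there is a sector
without edges, so that the face stays on the left (`IsRegion.leftOf_next`). The tracing step is
injective (`next_injective`); so the traced rings are the cycles of a permutation, and the sides
of the polygon of a face are exactly the directed edges with the face on their left
(`mem_sides_traced`). No edge has the same face on both sides (`isCell_face`): an edge inside the
rectangle separates two labels, and beyond an edge on the boundary of the rectangle there is no
face.

*Winding numbers.* For closed rings the total angle is a multiple of `2π`, locally constant off
the sides, zero far away, and it drops by `2π` when a side is crossed from left to right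
(`exists_jump`). Since the plane without the finitely many vertices is connected, statements about
winding numbers need to be checked only across inner points of edges (`forall_of_propagates`). For
the whole boundary of a face, this shows that the winding number is the indicator function of the
face (`IsBoundaryPart.totalAng_eq`). For any closed ring of edges along the face, let `c` be its
winding number around the face. It is `c` to the left and `c - 1` to the right of each side, so it
takes no other values, and as it is `0` far away, `c = 1` or `c = 0`: the ring is an outer ring or
the ring of a hole (`IsBoundaryPart.totalAng_values`). Therefore any cutting of the traced rings
into rings without repeated vertices will do. Only the outer ones among these wind around the
face, once each, and the total winding number there is `1`; so exactly one of them is an outer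
ring (`exists_outer_holes`).
-/

namespace ACPV

open Filter Set

/-! ### The two sides of a segment -/

/-- The signed position of `z` relative to the line through `u` and `v`: positive to the left of
the direction from `u` to `v`, negative to the right, and zero on the line. -/
noncomputable def side (u v z : ℂ) : ℝ := ((z - u) / (v - u)).im

theorem side_swap {u v : ℂ} (h : u ≠ v) (z : ℂ) : side v u z = -side u v z := by
  have h1 : v - u ≠ 0 := sub_ne_zero.2 h.symm
  have h2 : u - v ≠ 0 := sub_ne_zero.2 h
  have : (z - v) / (u - v) = 1 - (z - u) / (v - u) := by
    field_simp
    ring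
  simp [side, this]

theorem convex_side_pos (u v : ℂ) : Convex ℝ {z | 0 < side u v z} := by
  have hlin : IsLinearMap ℝ fun z : ℂ => (z / (v - u)).im :=
    ⟨fun a b => by simp [add_div], fun c a => by
      simp [mul_div_assoc]⟩
  convert! convex_halfSpace_gt hlin (u / (v - u)).im using 1
  ext z
  simp [side, sub_div]

theorem mem_openSegment_iff {u v p : ℂ} :
    p ∈ openSegment ℝ u v ↔ ∃ θ : ℝ, 0 < θ ∧ θ < 1 ∧ p = u + θ * (v - u) := by
  rw [openSegment_eq_image']
  constructor
  · rintro ⟨θ, h, rfl⟩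
    exact ⟨θ, h.1, h.2, by simp⟩
  · rintro ⟨θ, h, h', rfl⟩
    exact ⟨θ, ⟨h, h'⟩, by simp⟩

theorem side_eq_zero {u v p : ℂ} (h : u ≠ v) (hp : p ∈ openSegment ℝ u v) : side u v p = 0 := by
  obtain ⟨θ, -, -, rfl⟩ := mem_openSegment_iff.1 hp
  have h1 : v - u ≠ 0 := sub_ne_zero.2 h.symm
  simp [side, mul_div_cancel_right₀ _ h1]

theorem eventually_mem_openSegment {u v p : ℂ} (h : u ≠ v) (hp : p ∈ openSegment ℝ u v) :
    ∀ᶠ z in 𝓝 p, side u v z = 0 → z ∈ openSegment ℝ u v := by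
  have h1 : v - u ≠ 0 := sub_ne_zero.2 h.symm
  have hc : Continuous fun z : ℂ => ((z - u) / (v - u)).re :=
    Complex.continuous_re.comp ((continuous_id.sub continuous_const).div_const _)
  obtain ⟨θ, h0, h2, rfl⟩ := mem_openSegment_iff.1 hp
  have hm : ∀ᶠ z in 𝓝 (u + θ * (v - u)), ((z - u) / (v - u)).re ∈ Ioo (0 : ℝ) 1 := by
    refine hc.continuousAt.eventually_mem (Ioo_mem_nhds ?_ ?_) <;>
      simpa [mul_div_cancel_right₀ _ h1]
  filter_upwards [hm] with z hz hs
  refine mem_openSegment_iff.2 ⟨((z - u) / (v - u)).re, hz.1, hz.2, ?_⟩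
  have : ((((z - u) / (v - u)).re : ℝ) : ℂ) = (z - u) / (v - u) := by
    apply Complex.ext
    · simp
    · simpa [side] using hs.symm
  rw [this, div_mul_cancel₀ _ h1]
  ring

theorem side_add {u v p : ℂ} (h : u ≠ v) (hp : p ∈ openSegment ℝ u v) (t : ℝ) :
    side u v (p + t * (Complex.I * (v - u))) = t := by
  have h1 : v - u ≠ 0 := sub_ne_zero.2 h.symm
  have h0 := side_eq_zero h hp
  unfold side at *
  have : (p + t * (Complex.I * (v - u)) - u) / (v - u) = (p - u) / (v - u) + t * Complex.I := by
    field_simp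
    ring
  simp [this, h0]

theorem tendsto_add_normal (u v p : ℂ) :
    Tendsto (fun t : ℝ => p + t * (Complex.I * (v - u))) (𝓝[>] 0) (𝓝 p) := by
  have : Continuous fun t : ℝ => p + t * (Complex.I * (v - u)) := by fun_prop
  simpa using (this.tendsto 0).mono_left nhdsWithin_le_nhds

theorem frequently_side_pos {u v p : ℂ} (h : u ≠ v) (hp : p ∈ openSegment ℝ u v) :
    ∃ᶠ z in 𝓝 p, 0 < side u v z := by
  refine (tendsto_add_normal u v p).frequently (Eventually.frequently ?_)
  filter_upwards [self_mem_nhdsWithin] with t ht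
  rwa [side_add h hp]

/-! ### The angle under which a segment is seen -/

/-- The signed angle in `(-π, π]` under which the directed segment `s` is seen from `p`. -/
noncomputable def ang (s : ℂ × ℂ) (p : ℂ) : ℝ := Complex.arg ((s.2 - p) / (s.1 - p))

theorem continuousAt_ang {s : ℂ × ℂ} {p : ℂ} (hp : p ∉ segment ℝ s.1 s.2) :
    ContinuousAt (ang s) p := by
  have h1 : s.1 - p ≠ 0 := fun h => hp (by
    rw [← sub_eq_zero.1 h]; exact left_mem_segment ℝ _ _)
  have hs : (s.2 - p) / (s.1 - p) ∈ Complex.slitPlane := by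
    by_contra hn
    rw [Complex.mem_slitPlane_iff, not_or, not_lt, not_not] at hn
    obtain ⟨hre, him⟩ := hn
    set k : ℝ := -((s.2 - p) / (s.1 - p)).re with hk
    have hk0 : 0 ≤ k := by simp [hk, hre]
    have e : (s.2 - p) / (s.1 - p) = -(k : ℂ) := by
      apply Complex.ext <;> simp [hk, him]
    rw [div_eq_iff h1] at e
    have hk1 : (1 + k : ℝ) ≠ 0 := by positivity
    have hk1' : (1 + k : ℂ) ≠ 0 := by exact_mod_cast hk1
    refine hp ⟨k / (1 + k), 1 / (1 + k), by positivity, by positivity, by field_simp; ring, ?_⟩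
    simp only [Complex.real_smul]
    push_cast
    field_simp
    linear_combination e
  have hc : ContinuousAt (fun z => (s.2 - z) / (s.1 - z)) p :=
    (continuousAt_const.sub continuousAt_id).div (continuousAt_const.sub continuousAt_id) h1
  exact ContinuousAt.comp (f := fun z => (s.2 - z) / (s.1 - z)) (Complex.continuousAt_arg hs) hc

theorem tendsto_ang_of_mem_openSegment {u v p : ℂ} (h : u ≠ v) (hp : p ∈ openSegment ℝ u v) :
    Tendsto (ang (u, v)) (𝓝[{z | 0 < side u v z}] p) (𝓝 Real.pi) ∧
      Tendsto (ang (u, v)) (𝓝[{z | side u v z < 0}] p) (𝓝 (-Real.pi)) := by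
  have h1 : v - u ≠ 0 := sub_ne_zero.2 h.symm
  have hup : u - p ≠ 0 := by
    intro h0
    rw [← sub_eq_zero.1 h0, left_mem_openSegment_iff] at hp
    exact h hp
  have hc : ContinuousAt (fun z => (v - z) / (u - z)) p :=
    (continuousAt_const.sub continuousAt_id).div (continuousAt_const.sub continuousAt_id) hup
  obtain ⟨θ, h0, h2, hpe⟩ := mem_openSegment_iff.1 hp
  have hval : (v - p) / (u - p) = ((-((1 - θ) / θ) : ℝ) : ℂ) := by
    have : (θ : ℂ) ≠ 0 := by exact_mod_cast h0.ne'
    have h3 : u - p = -θ * (v - u) := by rw [hpe]; ring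
    have h4 : v - p = (1 - θ) * (v - u) := by rw [hpe]; ring
    rw [h3, h4]
    push_cast
    field_simp
  have hre : ((v - p) / (u - p)).re < 0 := by
    rw [hval, Complex.ofReal_re]
    have : 0 < (1 - θ) / θ := div_pos (by linarith) h0
    linarith
  have him : ((v - p) / (u - p)).im = 0 := by rw [hval, Complex.ofReal_im]
  -- the imaginary part of `(v - z) / (u - z)` has the sign of `side u v z`
  have hsign : ∀ z, u - z ≠ 0 → ((v - z) / (u - z)).im
      = side u v z / Complex.normSq ((z - u) / (v - u)) := by
    intro z hz
    have hz' : z - u ≠ 0 := by rwa [← neg_ne_zero, neg_sub]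
    have : (v - z) / (u - z) = 1 - ((z - u) / (v - u))⁻¹ := by
      field_simp
      ring
    rw [this, Complex.sub_im, Complex.inv_im, side]
    simp only [Complex.one_im]
    ring
  have hne : ∀ᶠ z in 𝓝 p, u - z ≠ 0 :=
    (continuousAt_const.sub continuousAt_id).eventually_ne hup
  have hnsq : ∀ z, u - z ≠ 0 → 0 < Complex.normSq ((z - u) / (v - u)) := by
    intro z hz
    have hz' : z - u ≠ 0 := by rwa [← neg_ne_zero, neg_sub]
    exact Complex.normSq_pos.2 (div_ne_zero hz' h1)
  constructor
  · refine (Complex.tendsto_arg_nhdsWithin_im_nonneg_of_re_neg_of_im_zero hre him).comp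
      (tendsto_nhdsWithin_iff.2 ⟨hc.tendsto.mono_left nhdsWithin_le_nhds, ?_⟩)
    filter_upwards [self_mem_nhdsWithin, mem_nhdsWithin_of_mem_nhds hne] with z hz hz'
    rw [hsign z hz']
    exact (div_pos hz (hnsq z hz')).le
  · refine (Complex.tendsto_arg_nhdsWithin_im_neg_of_re_neg_of_im_zero hre him).comp
      (tendsto_nhdsWithin_iff.2 ⟨hc.tendsto.mono_left nhdsWithin_le_nhds, ?_⟩)
    filter_upwards [self_mem_nhdsWithin, mem_nhdsWithin_of_mem_nhds hne] with z hz hz'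
    rw [hsign z hz']
    exact div_neg_of_neg_of_pos hz (hnsq z hz')

theorem tendsto_ang_cobounded (s : ℂ × ℂ) :
    Tendsto (ang s) (Bornology.cobounded ℂ) (𝓝 0) := by
  have h1 : Tendsto (fun p : ℂ => s.1 - p) (Bornology.cobounded ℂ) (Bornology.cobounded ℂ) :=
    tendsto_const_sub_cobounded _
  have h2 : Tendsto (fun p : ℂ => 1 + (s.2 - s.1) * (s.1 - p)⁻¹) (Bornology.cobounded ℂ) (𝓝 1) := by
    simpa using ((tendsto_inv₀_cobounded.comp h1).const_mul (s.2 - s.1)).const_add 1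
  have h3 : Tendsto (fun p : ℂ => (s.2 - p) / (s.1 - p)) (Bornology.cobounded ℂ) (𝓝 1) := by
    refine h2.congr' ?_
    filter_upwards [h1.eventually (Bornology.eventually_ne_cobounded 0)] with p hp
    field_simp
    ring
  have := (Complex.continuousAt_arg Complex.one_mem_slitPlane).tendsto.comp h3
  rw [Complex.arg_one] at this
  exact this

/-- The sum of the angles under which the directed segments in `S` are seen from `p`. -/
noncomputable def totalAng (S : Multiset (ℂ × ℂ)) (p : ℂ) : ℝ := (S.map fun s => ang s p).sum

/-- The points on the segments in `S`. -/
def carrier (S : Multiset (ℂ × ℂ)) : Set ℂ := ⋃ s ∈ S, segment ℝ s.1 s.2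

/-- Every point is the start of as many of the directed segments as it is the end of. -/
def Balanced (S : Multiset (ℂ × ℂ)) : Prop := S.map Prod.fst = S.map Prod.snd

theorem mem_carrier {S : Multiset (ℂ × ℂ)} {p : ℂ} :
    p ∈ carrier S ↔ ∃ s ∈ S, p ∈ segment ℝ s.1 s.2 := by
  simp [carrier]

theorem isClosed_segment (a b : ℂ) : IsClosed (segment ℝ a b) := by
  rw [← closure_openSegment]; exact isClosed_closure

theorem isClosed_carrier (S : Multiset (ℂ × ℂ)) : IsClosed (carrier S) := by
  classical
  have : carrier S = ⋃ s ∈ (S.toFinset : Set (ℂ × ℂ)), segment ℝ s.1 s.2 := by simp [carrier]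
  rw [this]
  exact S.toFinset.finite_toSet.isClosed_biUnion fun s _ => isClosed_segment _ _

theorem totalAng_add (S T : Multiset (ℂ × ℂ)) (p : ℂ) :
    totalAng (S + T) p = totalAng S p + totalAng T p := by simp [totalAng]

theorem totalAng_cons (s : ℂ × ℂ) (S : Multiset (ℂ × ℂ)) (p : ℂ) :
    totalAng (s ::ₘ S) p = ang s p + totalAng S p := by simp [totalAng]

theorem continuousAt_totalAng {S : Multiset (ℂ × ℂ)} {p : ℂ} (hp : p ∉ carrier S) :
    ContinuousAt (totalAng S) p := by
  induction S using Multiset.induction_on with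
  | empty => simpa [totalAng] using! continuousAt_const
  | cons s S ih =>
    rw [mem_carrier] at hp
    have e : totalAng (s ::ₘ S) = fun q => ang s q + totalAng S q :=
      funext fun q => totalAng_cons s S q
    rw [e]
    refine (continuousAt_ang fun h => hp ⟨s, by simp, h⟩).add (ih fun h => ?_)
    obtain ⟨t, ht, h⟩ := mem_carrier.1 h
    exact hp ⟨t, by simp [ht], h⟩

theorem tendsto_totalAng_cobounded (S : Multiset (ℂ × ℂ)) :
    Tendsto (totalAng S) (Bornology.cobounded ℂ) (𝓝 0) := by
  induction S using Multiset.induction_on with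
  | empty => simpa [totalAng] using! tendsto_const_nhds
  | cons s S ih =>
    have e : totalAng (s ::ₘ S) = fun q => ang s q + totalAng S q :=
      funext fun q => totalAng_cons s S q
    rw [e]
    simpa using (tendsto_ang_cobounded s).add ih

/-- The total angle of a balanced family is a multiple of `2π`: modulo `2π` it is a sum of
differences of directions, in which every end point cancels a start point. -/
theorem exists_totalAng_eq {S : Multiset (ℂ × ℂ)} (hS : Balanced S) {p : ℂ} (hp : p ∉ carrier S) :
    ∃ n : ℤ, totalAng S p = 2 * Real.pi * n := by
  have key : ∀ T : Multiset (ℂ × ℂ), p ∉ carrier T → ((totalAng T p : ℝ) : Real.Angle)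
      = ((T.map Prod.snd).map fun z => ((z - p).arg : Real.Angle)).sum
        - ((T.map Prod.fst).map fun z => ((z - p).arg : Real.Angle)).sum := by
    intro T hT
    induction T using Multiset.induction_on with
    | empty => simp [totalAng]
    | cons s T ih =>
      rw [mem_carrier] at hT
      have h1 : s.1 - p ≠ 0 := fun h => hT ⟨s, by simp, by
        rw [← sub_eq_zero.1 h]; exact left_mem_segment ℝ _ _⟩
      have h2 : s.2 - p ≠ 0 := fun h => hT ⟨s, by simp, by
        rw [← sub_eq_zero.1 h]; exact right_mem_segment ℝ _ _⟩
      have h3 := ih fun h => by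
        obtain ⟨t, ht, h⟩ := mem_carrier.1 h
        exact hT ⟨t, by simp [ht], h⟩
      rw [totalAng_cons, Real.Angle.coe_add, h3, ang, Complex.arg_div_coe_angle h2 h1]
      simp only [Multiset.map_cons, Multiset.sum_cons]
      abel
  have h := key S hp
  rw [show S.map Prod.fst = S.map Prod.snd from hS, sub_self, Real.Angle.coe_eq_zero_iff] at h
  obtain ⟨n, hn⟩ := h
  exact ⟨n, by rw [← hn]; simp; ring⟩

theorem two_pi_mul_int_inj {m n : ℤ} (h : 2 * Real.pi * (m : ℝ) = 2 * Real.pi * n) : m = n := by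
  have := mul_left_cancel₀ Real.two_pi_pos.ne' h
  exact_mod_cast this

/-- A function all of whose values near a limit point are multiples of `2π` is eventually constant,
because these multiples are isolated. -/
theorem eventually_eq_of_tendsto {α : Type*} {l : Filter α} {f : α → ℝ} {n : ℤ}
    (hf : Tendsto f l (𝓝 (2 * Real.pi * n))) (hint : ∀ᶠ x in l, ∃ m : ℤ, f x = 2 * Real.pi * m) :
    ∀ᶠ x in l, f x = 2 * Real.pi * n := by
  filter_upwards [hf (Metric.ball_mem_nhds _ Real.two_pi_pos), hint] with x hx ⟨m, hm⟩
  rw [mem_preimage, Metric.mem_ball, Real.dist_eq, hm, ← mul_sub, abs_mul,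
    abs_of_pos Real.two_pi_pos, mul_lt_iff_lt_one_right Real.two_pi_pos] at hx
  have : m - n = 0 := by
    have h : |m - n| < 1 := by exact_mod_cast hx
    exact Int.abs_lt_one_iff.1 h
  rw [hm, sub_eq_zero.1 this]

/-- Off the segments, the total angle of a balanced family is locally constant. -/
theorem eventually_totalAng_eq {S : Multiset (ℂ × ℂ)} (hS : Balanced S) {p : ℂ}
    (hp : p ∉ carrier S) : ∃ n : ℤ, totalAng S p = 2 * Real.pi * n ∧
      ∀ᶠ z in 𝓝 p, totalAng S z = 2 * Real.pi * n := by
  obtain ⟨n, hn⟩ := exists_totalAng_eq hS hp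
  refine ⟨n, hn, eventually_eq_of_tendsto (hn ▸ (continuousAt_totalAng hp).tendsto) ?_⟩
  filter_upwards [(isClosed_carrier S).isOpen_compl.mem_nhds hp] with z hz
  exact exists_totalAng_eq hS hz

theorem eventually_totalAng_eq_zero {S : Multiset (ℂ × ℂ)} (hS : Balanced S)
    (hb : ∀ᶠ z in Bornology.cobounded ℂ, z ∉ carrier S) :
    ∀ᶠ z in Bornology.cobounded ℂ, totalAng S z = 0 := by
  have h := eventually_eq_of_tendsto (n := 0) (by simpa using tendsto_totalAng_cobounded S)
    (hb.mono fun z hz => exists_totalAng_eq hS hz)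
  simpa using h

/-- The total angle of a balanced family drops by a full turn when a segment that is used once is
crossed from left to right. -/
theorem exists_jump {S : Multiset (ℂ × ℂ)} (hS : Balanced S) {u v p : ℂ} (huv : u ≠ v)
    (hp : p ∈ openSegment ℝ u v) (hmem : (u, v) ∈ S) (hoff : p ∉ carrier (S.erase (u, v))) :
    ∃ n : ℤ, ∀ᶠ z in 𝓝 p, (0 < side u v z → totalAng S z = 2 * Real.pi * n) ∧
      (side u v z < 0 → totalAng S z = 2 * Real.pi * (n - 1 : ℤ)) := by
  have e : totalAng S = fun q => ang (u, v) q + totalAng (S.erase (u, v)) q := by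
    funext q
    rw [← totalAng_cons, Multiset.cons_erase hmem]
  have hc := continuousAt_totalAng hoff
  obtain ⟨hl, hr⟩ := tendsto_ang_of_mem_openSegment huv hp
  have hl' : Tendsto (totalAng S) (𝓝[{z | 0 < side u v z}] p)
      (𝓝 (Real.pi + totalAng (S.erase (u, v)) p)) := by
    rw [e]; exact hl.add (hc.tendsto.mono_left nhdsWithin_le_nhds)
  have hr' : Tendsto (totalAng S) (𝓝[{z | side u v z < 0}] p)
      (𝓝 (-Real.pi + totalAng (S.erase (u, v)) p)) := by
    rw [e]; exact hr.add (hc.tendsto.mono_left nhdsWithin_le_nhds)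
  -- near `p` only the segment itself carries points of the family
  have hint : ∀ᶠ z in 𝓝 p, side u v z ≠ 0 → ∃ m : ℤ, totalAng S z = 2 * Real.pi * m := by
    have hseg : ∀ᶠ z in 𝓝 p, z ∈ segment ℝ u v → side u v z = 0 := by
      filter_upwards with z hz
      obtain ⟨θ, -, rfl⟩ := (segment_eq_image' ℝ u v) ▸ hz
      have h1 : v - u ≠ 0 := sub_ne_zero.2 huv.symm
      simp [side, mul_div_cancel_right₀ _ h1]
    filter_upwards [hseg, (isClosed_carrier _).isOpen_compl.mem_nhds hoff] with z h1 h2 h3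
    refine exists_totalAng_eq hS fun h => ?_
    obtain ⟨s, hs, hz⟩ := mem_carrier.1 h
    by_cases hsu : s = (u, v)
    · subst hsu
      exact h3 (h1 hz)
    · exact h2 (mem_carrier.2 ⟨s, (Multiset.mem_erase_of_ne hsu).2 hs, hz⟩)
  -- the limit from the left is a multiple of `2π`, as a limit of such multiples
  have hcl : IsClosed (range fun m : ℤ => 2 * Real.pi * (m : ℝ)) := by
    have : (range fun m : ℤ => 2 * Real.pi * (m : ℝ))
        = (AddSubgroup.zmultiples (2 * Real.pi) : Set ℝ) := by
      ext x
      simp [AddSubgroup.mem_zmultiples_iff, mul_comm]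
    rw [this]
    exact AddSubgroup.isClosed_of_discrete
  have hne : (𝓝[{z | 0 < side u v z}] p).NeBot := by
    exact mem_closure_iff_nhdsWithin_neBot.1
      (mem_closure_iff_frequently.2 (frequently_side_pos huv hp))
  have hintl : ∀ᶠ z in 𝓝[{z | 0 < side u v z}] p, ∃ m : ℤ, totalAng S z = 2 * Real.pi * m := by
    filter_upwards [self_mem_nhdsWithin, mem_nhdsWithin_of_mem_nhds hint] with z hz h
    exact h (ne_of_gt hz)
  have hintr : ∀ᶠ z in 𝓝[{z | side u v z < 0}] p, ∃ m : ℤ, totalAng S z = 2 * Real.pi * m := by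
    filter_upwards [self_mem_nhdsWithin, mem_nhdsWithin_of_mem_nhds hint] with z hz h
    exact h (ne_of_lt hz)
  obtain ⟨n, hn⟩ := hcl.mem_of_tendsto hl' (hintl.mono fun z ⟨m, hm⟩ => ⟨m, hm.symm⟩)
  have hn : 2 * Real.pi * (n : ℝ) = Real.pi + totalAng (S.erase (u, v)) p := hn
  have hn' : 2 * Real.pi * ((n - 1 : ℤ) : ℝ) = -Real.pi + totalAng (S.erase (u, v)) p := by
    push_cast
    linarith
  have h1 := eventually_eq_of_tendsto (hn ▸ hl') hintl
  have h2 := eventually_eq_of_tendsto (hn' ▸ hr') hintr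
  exact ⟨n, (eventually_nhdsWithin_iff.1 h1).and (eventually_nhdsWithin_iff.1 h2)⟩

/-- To show that `Q` holds off the set `B`, it suffices that `Q` propagates across all points
except finitely many, since the plane without a finite set is connected. -/
theorem forall_of_propagates {B V : Set ℂ} {Q : ℂ → Prop} (hB : interior B = ∅) (hV : V.Finite)
    (hVB : V ⊆ B)
    (hprop : ∀ p ∉ V, (∀ᶠ z in 𝓝 p, z ∉ B → Q z) ∨ ∀ᶠ z in 𝓝 p, z ∉ B → ¬ Q z)
    (hex : ∃ p ∉ V, ∀ᶠ z in 𝓝 p, z ∉ B → Q z) {p : ℂ} (hp : p ∉ B) : Q p := by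
  have hconn : IsPreconnected Vᶜ :=
    (hV.countable.isConnected_compl_of_one_lt_rank (by simp)).isPreconnected
  have hopen : ∀ R : ℂ → Prop, IsOpen {p | ∀ᶠ z in 𝓝 p, z ∉ B → R z} := fun R =>
    isOpen_iff_mem_nhds.2 fun p hp => eventually_eventually_nhds.2 hp
  rw [isPreconnected_iff_subset_of_disjoint] at hconn
  have hd : Vᶜ ∩ ({p | ∀ᶠ z in 𝓝 p, z ∉ B → Q z} ∩ {p | ∀ᶠ z in 𝓝 p, z ∉ B → ¬ Q z}) = ∅ := by
    refine eq_empty_iff_forall_notMem.2 fun q ⟨_, h1, h2⟩ => ?_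
    have h : q ∈ interior B := by
      rw [mem_interior_iff_mem_nhds]
      filter_upwards [h1, h2] with z hz hz'
      by_contra hB
      exact hz' hB (hz hB)
    rw [hB] at h
    exact h
  have hpV : p ∈ Vᶜ := fun h => hp (hVB h)
  obtain ⟨q, hq, hqQ⟩ := hex
  rcases hconn _ _ (hopen Q) (hopen fun z => ¬ Q z) (fun p hp => hprop p hp) hd with h | h
  · exact (h hpV).self_of_nhds hp
  · exact absurd (mem_empty_iff_false q |>.1 (hd ▸ ⟨hq, hqQ, h hq⟩)) id

/-! ### The graph near a point of an edge and near a vertex -/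

namespace PSLG

variable {G : PSLG}

theorem mem_support {p : ℂ} :
    p ∈ G.support ↔ p ∈ G.verts ∨ ∃ u v, G.graph.Adj u v ∧ p ∈ segment ℝ u v := by
  simp [support]

theorem openSegment_subset_support {u v : ℂ} (h : G.graph.Adj u v) :
    openSegment ℝ u v ⊆ G.support := fun _ hp =>
  mem_support.2 (.inr ⟨u, v, h, openSegment_subset_segment ℝ u v hp⟩)

theorem mem_verts_or_mem_openSegment {p : ℂ} (hp : p ∈ G.support) :
    p ∈ G.verts ∨ ∃ u v, G.graph.Adj u v ∧ p ∈ openSegment ℝ u v := by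
  rcases mem_support.1 hp with h | ⟨u, v, h, hp⟩
  · exact .inl h
  · rw [← insert_endpoints_openSegment] at hp
    rcases hp with rfl | rfl | hp
    · exact .inl (G.mem_verts _ _ h)
    · exact .inl (G.mem_verts _ _ h.symm)
    · exact .inr ⟨u, v, h, hp⟩

theorem isClosed_iUnion_darts (R : G.graph.Dart → Prop) :
    IsClosed (⋃ d ∈ {d | R d}, segment ℝ d.fst d.snd) :=
  (Set.toFinite _).isClosed_biUnion fun _ _ => isClosed_segment _ _

theorem isClosed_support : IsClosed G.support := by
  have : G.support = (G.verts : Set ℂ) ∪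
      ⋃ d ∈ {_d : G.graph.Dart | True}, segment ℝ d.fst d.snd := by
    ext p
    simp only [mem_support, mem_union, Finset.mem_coe, mem_iUnion, exists_prop]
    refine or_congr_right ⟨fun ⟨u, v, h, hp⟩ => ⟨⟨(u, v), h⟩, trivial, hp⟩,
      fun ⟨d, _, hp⟩ => ⟨_, _, d.adj, hp⟩⟩
  rw [this]
  exact G.verts.finite_toSet.isClosed.union (isClosed_iUnion_darts _)

/-- Distinct edges meet only in common endpoints. -/
theorem notMem_segment_of_mem_openSegment {u v w x p : ℂ} (h : G.graph.Adj u v)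
    (h' : G.graph.Adj w x) (hne : s(u, v) ≠ s(w, x)) (hp : p ∈ openSegment ℝ u v) :
    p ∉ segment ℝ w x := by
  intro hq
  rw [← insert_endpoints_openSegment] at hq
  rcases hq with rfl | rfl | hq
  · exact G.vertex_notMem _ _ _ h (G.mem_verts _ _ h') hp
  · exact G.vertex_notMem _ _ _ h (G.mem_verts _ _ h'.symm) hp
  · exact disjoint_left.1 (G.disjoint_edges _ _ _ _ h h' hne) hp hq

theorem eventually_mem_openSegment_of_mem_support {u v p : ℂ} (h : G.graph.Adj u v)
    (hp : p ∈ openSegment ℝ u v) : ∀ᶠ z in 𝓝 p, z ∈ G.support → z ∈ openSegment ℝ u v := by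
  have h1 : p ∉ (G.verts : Set ℂ) := fun hv => G.vertex_notMem _ _ _ h hv hp
  have h2 : p ∉ ⋃ d ∈ {d : G.graph.Dart | d.edge ≠ s(u, v)}, segment ℝ d.fst d.snd := by
    simp only [mem_iUnion, not_exists]
    exact fun d hd => notMem_segment_of_mem_openSegment h d.adj (Ne.symm hd) hp
  filter_upwards [G.verts.finite_toSet.isClosed.isOpen_compl.mem_nhds h1,
    (isClosed_iUnion_darts fun d : G.graph.Dart => d.edge ≠ s(u, v)).isOpen_compl.mem_nhds h2]
    with z hz1 hz2 hz
  rcases mem_verts_or_mem_openSegment hz with hz | ⟨w, x, hwx, hz⟩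
  · exact absurd hz hz1
  · by_cases he : s(w, x) = s(u, v)
    · rcases Sym2.eq_iff.1 he with ⟨rfl, rfl⟩ | ⟨rfl, rfl⟩
      · exact hz
      · rwa [openSegment_symm]
    · refine absurd ?_ hz2
      simp only [mem_iUnion]
      exact ⟨⟨(w, x), hwx⟩, he, openSegment_subset_segment ℝ _ _ hz⟩

theorem eventually_mem_segment_of_mem_support {v : ℂ} (hv : v ∈ G.verts) :
    ∀ᶠ z in 𝓝 v, z ∈ G.support → z = v ∨ ∃ w, G.graph.Adj v w ∧ z ∈ segment ℝ v w := by
  have h1 : v ∉ ((G.verts.erase v : Finset ℂ) : Set ℂ) := by simp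
  have h2 : v ∉ ⋃ d ∈ {d : G.graph.Dart | v ∉ segment ℝ d.fst d.snd}, segment ℝ d.fst d.snd := by
    simp only [mem_iUnion, not_exists]
    exact fun d hd => hd
  filter_upwards [(Finset.finite_toSet _).isClosed.isOpen_compl.mem_nhds h1,
    (isClosed_iUnion_darts fun d : G.graph.Dart =>
      v ∉ segment ℝ d.fst d.snd).isOpen_compl.mem_nhds h2] with z hz1 hz2 hz
  rcases mem_support.1 hz with hz | ⟨w, x, hwx, hz⟩
  · refine .inl (by_contra fun hne => hz1 ?_)
    simpa [hne] using hz
  · have hs : v ∈ segment ℝ w x := by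
      by_contra hs
      refine hz2 ?_
      simp only [mem_iUnion]
      exact ⟨⟨(w, x), hwx⟩, hs, hz⟩
    rw [← insert_endpoints_openSegment] at hs
    rcases hs with rfl | rfl | hs
    · exact .inr ⟨x, hwx, hz⟩
    · exact .inr ⟨w, hwx.symm, by rwa [segment_symm]⟩
    · exact absurd hs (G.vertex_notMem _ _ _ hwx hv)

theorem exists_sub_eq_of_mem_segment {v w z : ℂ} (hz : z ∈ segment ℝ v w) (hne : z ≠ v) :
    ∃ t : ℝ, 0 < t ∧ t ≤ 1 ∧ z - v = t * (w - v) := by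
  rw [segment_eq_image'] at hz
  obtain ⟨t, ⟨h0, h1⟩, rfl⟩ := hz
  refine ⟨t, h0.lt_of_ne fun h => hne ?_, h1, by simp⟩
  simp [← h]

/-- Distinct edges at a vertex leave it in distinct directions. -/
theorem eq_of_same_direction {v x y : ℂ} (hx : G.graph.Adj v x) (hy : G.graph.Adj v y) {c : ℝ}
    (hc : 0 < c) (h : y - v = c * (x - v)) : x = y := by
  by_contra hne
  have hs : s(v, x) ≠ s(v, y) := by
    rw [Ne, Sym2.eq_iff]
    rintro (⟨-, rfl⟩ | ⟨rfl, rfl⟩) <;> exact hne rfl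
  set t : ℝ := min 1 c / 2 with ht
  have hm : 0 < min 1 c := lt_min one_pos hc
  have h1 : min 1 c ≤ 1 := min_le_left _ _
  have h2 : min 1 c ≤ c := min_le_right _ _
  refine disjoint_left.1 (G.disjoint_edges _ _ _ _ hx hy hs)
    (mem_openSegment_iff.2 ⟨t, by positivity, by linarith, rfl⟩)
    (mem_openSegment_iff.2 ⟨t / c, by positivity, (div_lt_one hc).2 (by linarith), ?_⟩)
  have : (c : ℂ) ≠ 0 := by exact_mod_cast hc.ne'
  rw [h]
  push_cast
  field_simp

/-! ### Clockwise angles and the tracing step -/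

theorem cwAngle_mem (a b : ℂ) : 0 < cwAngle a b ∧ cwAngle a b ≤ 2 * Real.pi := by
  have := toIocMod_mem_Ioc Real.two_pi_pos 0 (Complex.arg (a / b))
  rw [zero_add] at this
  exact this

/-- Turning `a` clockwise by an angle in `(0, 2π]` and rescaling it gives this clockwise angle. -/
theorem cwAngle_rotate {a : ℂ} (ha : a ≠ 0) {r θ : ℝ} (hr : 0 < r) (h0 : 0 < θ)
    (h1 : θ ≤ 2 * Real.pi) : cwAngle a (r * a * Complex.exp (-(θ * Complex.I))) = θ := by
  have hr' : (r : ℂ) ≠ 0 := by exact_mod_cast hr.ne'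
  have : a / (r * a * Complex.exp (-(θ * Complex.I)))
      = ((r⁻¹ : ℝ) : ℂ) * Complex.exp (θ * Complex.I) := by
    rw [Complex.exp_neg]
    have := Complex.exp_ne_zero (θ * Complex.I)
    push_cast
    field_simp
  rw [cwAngle, this, Complex.arg_real_mul _ (inv_pos.2 hr), Complex.arg_exp_mul_I,
    toIocMod_toIocMod, toIocMod_eq_self]
  exact ⟨h0, by simpa using h1⟩

/-- The direction `b` arises from `a` by turning it clockwise by the angle between them. -/
theorem eq_rotate_cwAngle {a b : ℂ} (ha : a ≠ 0) (hb : b ≠ 0) :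
    ∃ r : ℝ, 0 < r ∧ b = r * a * Complex.exp (-(cwAngle a b * Complex.I)) := by
  have hexp : Complex.exp (cwAngle a b * Complex.I)
      = Complex.exp (Complex.arg (a / b) * Complex.I) := by
    rw [cwAngle, toIocMod, Complex.exp_eq_exp_iff_exists_int]
    refine ⟨-toIocDiv Real.two_pi_pos 0 (Complex.arg (a / b)), ?_⟩
    push_cast
    simp
    ring
  have hn : 0 < ‖a / b‖ := norm_pos_iff.2 (div_ne_zero ha hb)
  refine ⟨‖a / b‖⁻¹, inv_pos.2 hn, ?_⟩
  have h := Complex.norm_mul_exp_arg_mul_I (a / b)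
  rw [Complex.exp_neg, hexp]
  have h1 := Complex.exp_ne_zero (Complex.arg (a / b) * Complex.I)
  have h2 : ((‖a / b‖ : ℝ) : ℂ) ≠ 0 := by exact_mod_cast hn.ne'
  rw [eq_div_iff hb, mul_comm _ b] at h
  push_cast
  set N : ℂ := ((‖a / b‖ : ℝ) : ℂ)
  set E := Complex.exp (Complex.arg (a / b) * Complex.I)
  rw [← h]
  field_simp

theorem cwAngle_next_le (d : G.graph.Dart) {x : ℂ} (hx : G.graph.Adj d.snd x) :
    cwAngle (d.fst - d.snd) ((G.next d).snd - d.snd) ≤ cwAngle (d.fst - d.snd) (x - d.snd) :=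
  (Classical.choose_spec (G.exists_next d)).2 x hx

/-- Two edges that arrive at the same vertex are followed by different edges: otherwise the one at
the smaller angle to the common successor would come before it after the other one. -/
theorem next_injective : Function.Injective G.next := by
  have key : ∀ d e : G.graph.Dart, G.next d = G.next e →
      cwAngle (e.fst - e.snd) ((G.next e).snd - e.snd)
        ≤ cwAngle (d.fst - d.snd) ((G.next d).snd - d.snd) → d = e := by
    intro d e h hle
    have hv : d.snd = e.snd := congrArg (fun x : G.graph.Dart => x.fst) h
    have hda : d.fst - d.snd ≠ 0 := sub_ne_zero.2 d.adj.ne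
    have hea : e.fst - d.snd ≠ 0 := by rw [hv]; exact sub_ne_zero.2 e.adj.ne
    have hb : (G.next d).snd - d.snd ≠ 0 := sub_ne_zero.2 (G.next d).adj.ne'
    have hmin := cwAngle_next_le d (x := e.fst) (hv ▸ e.adj.symm)
    rw [← h, ← hv] at hle
    obtain ⟨r, hr, h1⟩ := eq_rotate_cwAngle hda hb
    obtain ⟨r', hr', h2⟩ := eq_rotate_cwAngle hea hb
    have m1 := cwAngle_mem (d.fst - d.snd) ((G.next d).snd - d.snd)
    have m2 := cwAngle_mem (e.fst - d.snd) ((G.next d).snd - d.snd)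
    set α := cwAngle (d.fst - d.snd) ((G.next d).snd - d.snd)
    set α' := cwAngle (e.fst - d.snd) ((G.next d).snd - d.snd)
    have hrc : (r' : ℂ) ≠ 0 := by exact_mod_cast hr'.ne'
    have hE : e.fst - d.snd = ((r / r' : ℝ) : ℂ) * (d.fst - d.snd)
        * Complex.exp (-((α - α' : ℝ) * Complex.I)) := by
      have hx : Complex.exp (-((α - α' : ℝ) * Complex.I))
          = Complex.exp (-(α * Complex.I)) * (Complex.exp (-(α' * Complex.I)))⁻¹ := by
        rw [← Complex.exp_neg, ← Complex.exp_add]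
        congr 1
        push_cast
        ring
      have h3 := h1.symm.trans h2
      have h4 := Complex.exp_ne_zero (-(α' * Complex.I))
      rw [hx]
      generalize Complex.exp (-(α' * Complex.I)) = E' at *
      generalize Complex.exp (-(α * Complex.I)) = E at *
      push_cast
      field_simp
      linear_combination -h3
    rcases hle.lt_or_eq with hlt | heq
    · rw [hE, cwAngle_rotate hda (div_pos hr hr') (sub_pos.2 hlt) (by linarith)] at hmin
      linarith
    · rw [heq, sub_self] at hE
      have := eq_of_same_direction d.adj.symm (hv ▸ e.adj.symm) (div_pos hr hr')
        (by simpa using hE)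
      exact SimpleGraph.Dart.ext _ _ (Prod.ext this hv)
  intro d e h
  rcases le_total (cwAngle (e.fst - e.snd) ((G.next e).snd - e.snd))
    (cwAngle (d.fst - d.snd) ((G.next d).snd - d.snd)) with hle | hle
  · exact key d e h hle
  · exact (key e d h.symm hle).symm

/-! ### Regions cut out by the graph -/

/-- `F` is a union of faces: an open set disjoint from the graph and bounded by points of
the graph. -/
structure IsRegion (G : PSLG) (F : Set ℂ) : Prop where
  isOpen : IsOpen F
  notMem : ∀ z ∈ F, z ∉ G.support
  frontier_subset : frontier F ⊆ G.support

/-- The set `F` lies to the left of the segment from `u` to `v`, near every inner point of it. -/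
def LeftOf (F : Set ℂ) (u v : ℂ) : Prop :=
  ∀ p ∈ openSegment ℝ u v, ∀ᶠ z in 𝓝 p, 0 < side u v z → z ∈ F

variable {F : Set ℂ}

theorem exists_mem_frontier {T : Set ℂ} (hT : IsPreconnected T) (h : (T ∩ F).Nonempty)
    (h' : (T \ F).Nonempty) : ∃ x ∈ T, x ∈ frontier F := by
  by_contra! hn
  have hin : ∀ x ∈ T, x ∈ F → x ∈ interior F := fun x hx hxF =>
    by_contra fun h => hn x hx ⟨subset_closure hxF, h⟩
  have hout : ∀ x ∈ T, x ∉ F → x ∈ (closure F)ᶜ := fun x hx hxF hc =>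
    hn x hx ⟨hc, fun h => hxF (interior_subset h)⟩
  obtain ⟨x, hx, hxF⟩ := h
  obtain ⟨y, hy, hyF⟩ := h'
  obtain ⟨z, -, hz, hz'⟩ := hT (interior F) (closure F)ᶜ isOpen_interior
    isClosed_closure.isOpen_compl
    (fun z hz => (em (z ∈ F)).imp (hin z hz) (hout z hz))
    ⟨x, hx, hin x hx hxF⟩ ⟨y, hy, hout y hy hyF⟩
  exact hz' (subset_closure (interior_subset hz))

theorem IsRegion.subset_of_isPreconnected (hF : G.IsRegion F) {T : Set ℂ} (hT : IsPreconnected T)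
    (hd : ∀ z ∈ T, z ∉ G.support) (hne : (T ∩ F).Nonempty) : T ⊆ F := by
  by_contra hn
  obtain ⟨z, hz, hzF⟩ := not_subset.1 hn
  obtain ⟨x, hx, hxF⟩ := exists_mem_frontier hT hne ⟨z, hz, hzF⟩
  exact hd x hx (hF.frontier_subset hxF)

/-- Near an inner point of an edge, the points to the left of the edge form a half-disc, which is
connected and does not meet the graph. -/
theorem exists_halfDisc {u v p : ℂ} (h : G.graph.Adj u v) (hp : p ∈ openSegment ℝ u v) {N : Set ℂ}
    (hN : N ∈ 𝓝 p) : ∃ T ⊆ N, IsPreconnected T ∧ (∀ z ∈ T, z ∉ G.support) ∧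
      (∀ z ∈ T, 0 < side u v z) ∧ ∀ᶠ z in 𝓝 p, 0 < side u v z → z ∈ T := by
  obtain ⟨r, hr, hb⟩ := Metric.mem_nhds_iff.1
    (inter_mem hN (eventually_mem_openSegment_of_mem_support h hp))
  refine ⟨Metric.ball p r ∩ {z | 0 < side u v z}, fun z hz => (hb hz.1).1,
    ((convex_ball p r).inter (convex_side_pos u v)).isPreconnected, fun z hz hs => ?_,
    fun z hz => hz.2, ?_⟩
  · exact hz.2.ne' (side_eq_zero h.ne ((hb hz.1).2 hs))
  · filter_upwards [Metric.ball_mem_nhds p hr] with z hz hs using ⟨hz, hs⟩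

theorem IsRegion.left_dichotomy (hF : G.IsRegion F) {u v p : ℂ} (h : G.graph.Adj u v)
    (hp : p ∈ openSegment ℝ u v) : (∀ᶠ z in 𝓝 p, 0 < side u v z → z ∈ F) ∨
      ∀ᶠ z in 𝓝 p, 0 < side u v z → z ∉ F := by
  obtain ⟨T, -, hT, hd, -, hev⟩ := exists_halfDisc h hp univ_mem
  by_cases hne : (T ∩ F).Nonempty
  · have := hF.subset_of_isPreconnected hT hd hne
    exact .inl (hev.mono fun z hz hs => this (hz hs))
  · exact .inr (hev.mono fun z hz hs hzF => hne ⟨z, hz hs, hzF⟩)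

/-- As an open segment is connected, a region that touches an edge from the left at one inner
point lies to the left of the whole edge. -/
theorem IsRegion.leftOf_of_frequently (hF : G.IsRegion F) {u v p : ℂ} (h : G.graph.Adj u v)
    (hp : p ∈ openSegment ℝ u v) (hfr : ∃ᶠ z in 𝓝 p, 0 < side u v z ∧ z ∈ F) : LeftOf F u v := by
  have hopen : ∀ R : ℂ → Prop, IsOpen {p | ∀ᶠ z in 𝓝 p, 0 < side u v z → R z} := fun R =>
    isOpen_iff_mem_nhds.2 fun p hp => eventually_eventually_nhds.2 hp
  have hconn := (convex_openSegment (𝕜 := ℝ) u v).isPreconnected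
  rw [isPreconnected_iff_subset_of_disjoint] at hconn
  have hdisj : openSegment ℝ u v ∩ ({p | ∀ᶠ z in 𝓝 p, 0 < side u v z → z ∈ F} ∩
      {p | ∀ᶠ z in 𝓝 p, 0 < side u v z → z ∉ F}) = ∅ := by
    refine eq_empty_iff_forall_notMem.2 fun q ⟨hq, h1, h2⟩ => ?_
    obtain ⟨z, hz, h1, h2⟩ := ((frequently_side_pos h.ne hq).and_eventually
      (Filter.Eventually.and h1 h2)).exists
    exact h2 hz (h1 hz)
  rcases hconn _ _ (hopen (· ∈ F)) (hopen (· ∉ F)) (fun q hq => hF.left_dichotomy h hq) hdisj with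
    hs | hs
  · exact fun q hq => hs hq
  · exfalso
    obtain ⟨z, ⟨hz, hzF⟩, hz'⟩ := (hfr.and_eventually (hs hp)).exists
    exact hz' hz hzF

theorem IsRegion.eventually_notMem (hF : G.IsRegion F) {u v p : ℂ} (h : G.graph.Adj u v)
    (hn : ¬ LeftOf F u v) (hp : p ∈ openSegment ℝ u v) :
    ∀ᶠ z in 𝓝 p, 0 < side u v z → z ∉ F := by
  by_contra hc
  refine hn (hF.leftOf_of_frequently h hp ?_)
  simpa only [not_eventually, Classical.not_imp, not_not] using hc

theorem IsRegion.leftOf_or_of_mem_frontier (hF : G.IsRegion F) {u v p : ℂ} (h : G.graph.Adj u v)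
    (hp : p ∈ openSegment ℝ u v) (hpF : p ∈ frontier F) : LeftOf F u v ∨ LeftOf F v u := by
  by_contra hn
  rw [not_or] at hn
  have h1 := hF.eventually_notMem h hn.1 hp
  have h2 := hF.eventually_notMem h.symm hn.2 (openSegment_symm ℝ u v ▸ hp)
  have hfr := mem_closure_iff_frequently.1 (frontier_subset_closure hpF)
  obtain ⟨z, hz, h1, h2, h3⟩ := (hfr.and_eventually
    (h1.and (h2.and (eventually_mem_openSegment h.ne hp)))).exists
  rw [side_swap h.ne] at h2
  rcases lt_trichotomy (side u v z) 0 with hs | hs | hs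
  · exact h2 (by linarith) hz
  · exact hF.notMem z hz (openSegment_subset_support h (h3 hs))
  · exact h1 hs hz

theorem IsRegion.segment_subset_frontier (hF : G.IsRegion F) {u v : ℂ} (h : G.graph.Adj u v)
    (hl : LeftOf F u v) : segment ℝ u v ⊆ frontier F := by
  rw [← closure_openSegment]
  refine closure_minimal (fun p hp => ?_) isClosed_frontier
  rw [hF.isOpen.frontier_eq]
  refine ⟨mem_closure_iff_frequently.2 ?_,
    fun hpF => hF.notMem p hpF (openSegment_subset_support h hp)⟩
  exact ((frequently_side_pos h.ne hp).and_eventually (hl p hp)).mono fun z hz => hz.2 hz.1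

theorem isPreconnected_ball_diff (v : ℂ) (r : ℝ) : IsPreconnected (Metric.ball v r \ {v}) := by
  have hg : Continuous fun x : ℝ × ℝ => v + x.1 * Complex.exp (x.2 * Complex.I) := by fun_prop
  convert! ((isPreconnected_Ioo (a := 0) (b := r)).prod isPreconnected_univ).image _
    hg.continuousOn using 1
  ext z
  constructor
  · rintro ⟨hz, hne⟩
    have hne : z - v ≠ 0 := sub_ne_zero.2 hne
    rw [Metric.mem_ball, dist_eq_norm] at hz
    refine ⟨(‖z - v‖, Complex.arg (z - v)), ⟨⟨norm_pos_iff.2 hne, hz⟩, mem_univ _⟩, ?_⟩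
    simp [Complex.norm_mul_exp_arg_mul_I]
  · rintro ⟨⟨s, φ⟩, ⟨⟨h0, h1⟩, -⟩, rfl⟩
    have h0 : 0 < s := h0
    have h1 : s < r := h1
    refine ⟨?_, ?_⟩
    · rw [Metric.mem_ball, dist_eq_norm]
      simpa [Complex.norm_exp_ofReal_mul_I, abs_of_pos h0] using h1
    · simp [h0.ne', Complex.exp_ne_zero]

/-- The frontier of a region consists of the edges along it: a vertex of the frontier off
these edges would have a punctured neighbourhood inside the region, yet some edge ends there. -/
theorem IsRegion.frontier_eq (hF : G.IsRegion F)
    (hdeg : ∀ v ∈ G.verts, ∃ w, G.graph.Adj v w) :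
    frontier F = ⋃ d ∈ {d : G.graph.Dart | LeftOf F d.fst d.snd}, segment ℝ d.fst d.snd := by
  have hedge : ∀ {u v p}, G.graph.Adj u v → p ∈ openSegment ℝ u v → p ∈ frontier F →
      p ∈ ⋃ d ∈ {d : G.graph.Dart | LeftOf F d.fst d.snd}, segment ℝ d.fst d.snd := by
    intro u v p h hp hpF
    simp only [mem_iUnion]
    rcases hF.leftOf_or_of_mem_frontier h hp hpF with hl | hl
    · exact ⟨⟨(u, v), h⟩, hl, openSegment_subset_segment ℝ _ _ hp⟩
    · exact ⟨⟨(v, u), h.symm⟩, hl, segment_symm ℝ u v ▸ openSegment_subset_segment ℝ _ _ hp⟩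
  refine Subset.antisymm (fun p hpF => ?_) ?_
  · rcases mem_verts_or_mem_openSegment (hF.frontier_subset hpF) with hv | ⟨u, v, h, hp⟩
    · by_contra hpB
      have hev := (isClosed_iUnion_darts fun d : G.graph.Dart =>
        LeftOf F d.fst d.snd).isOpen_compl.mem_nhds hpB
      have hev' := (Finset.finite_toSet (G.verts.erase p)).isClosed.isOpen_compl.mem_nhds
        (show p ∉ ((G.verts.erase p : Finset ℂ) : Set ℂ) by simp)
      obtain ⟨r, hr, hb⟩ := Metric.mem_nhds_iff.1 (inter_mem hev hev')
      have hfr : ∀ z ∈ Metric.ball p r \ {p}, z ∉ frontier F := by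
        rintro z ⟨hz, hne⟩ hzF
        rcases mem_verts_or_mem_openSegment (hF.frontier_subset hzF) with hv' | ⟨u, v, h, hq⟩
        · refine (hb hz).2 ?_
          have : z ≠ p := hne
          simpa [this] using hv'
        · exact (hb hz).1 (hedge h hq hzF)
      have hsub : Metric.ball p r \ {p} ⊆ F := by
        by_contra hn
        obtain ⟨z, hz, hzF⟩ := not_subset.1 hn
        obtain ⟨y, hyF, hy⟩ := ((mem_closure_iff_frequently.1
          (frontier_subset_closure hpF)).and_eventually (Metric.ball_mem_nhds p hr)).exists
        have hyp : y ≠ p := by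
          rintro rfl
          exact hF.notMem y hyF (hF.frontier_subset hpF)
        obtain ⟨x, hx, hxF⟩ := exists_mem_frontier (isPreconnected_ball_diff p r)
          ⟨y, ⟨hy, hyp⟩, hyF⟩ ⟨z, hz, hzF⟩
        exact hfr x hx hxF
      obtain ⟨w, hw⟩ := hdeg p hv
      have hcl : p ∈ closure (openSegment ℝ p w) := by
        rw [closure_openSegment]; exact left_mem_segment ℝ _ _
      obtain ⟨y, hy, hyb⟩ := ((mem_closure_iff_frequently.1 hcl).and_eventually
        (Metric.ball_mem_nhds p hr)).exists
      have hyp : y ≠ p := by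
        rintro rfl
        rw [left_mem_openSegment_iff] at hy
        exact hw.ne hy
      exact hF.notMem y (hsub ⟨hyb, hyp⟩) (openSegment_subset_support hw hy)
    · exact hedge h hp hpF
  · exact iUnion₂_subset fun d hd => hF.segment_subset_frontier d.adj hd

/-- Tracing keeps the region on the left: between an edge and its successor there is a sector
that no edge enters, so that it lies in the region. -/
theorem IsRegion.leftOf_next (hF : G.IsRegion F) {d : G.graph.Dart}
    (hd : LeftOf F d.fst d.snd) : LeftOf F (G.next d).fst (G.next d).snd := by
  set u := d.fst
  set v := d.snd
  set w := (G.next d).snd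
  have huv : G.graph.Adj u v := d.adj
  have hvw : G.graph.Adj v w := (G.next d).adj
  have hne : u - v ≠ 0 := sub_ne_zero.2 huv.ne
  have hne' : w - v ≠ 0 := sub_ne_zero.2 hvw.ne'
  obtain ⟨c, hc, hcw⟩ := eq_rotate_cwAngle hne hne'
  obtain ⟨hθ0, hθ1⟩ := cwAngle_mem (u - v) (w - v)
  have hmin : ∀ x, G.graph.Adj v x → cwAngle (u - v) (w - v) ≤ cwAngle (u - v) (x - v) :=
    fun x hx => cwAngle_next_le d hx
  set θ := cwAngle (u - v) (w - v)
  let g : ℝ × ℝ → ℂ := fun x => v + x.1 * (u - v) * Complex.exp (-(x.2 * Complex.I))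
  have hg : Continuous g := by fun_prop
  obtain ⟨r, hr, hb⟩ := Metric.mem_nhds_iff.1
    (eventually_mem_segment_of_mem_support (G := G) (G.mem_verts _ _ huv.symm))
  -- chosen so small that in the sector only edges at `v` could occur
  set ρ : ℝ := r / ‖u - v‖ with hρ
  have hρ0 : 0 < ρ := div_pos hr (norm_pos_iff.2 hne)
  let T : Set ℂ := g '' (Ioo 0 ρ ×ˢ Ioo 0 θ)
  have hT : IsPreconnected T :=
    (isPreconnected_Ioo.prod isPreconnected_Ioo).image g hg.continuousOn
  have hTs : ∀ z ∈ T, z ∉ G.support := by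
    rintro _ ⟨⟨s, φ⟩, ⟨⟨hs0, hs1⟩, ⟨hφ0, hφ1⟩⟩, rfl⟩ hz
    dsimp only at hs0 hs1 hφ0 hφ1
    have hsC : (s : ℂ) ≠ 0 := by exact_mod_cast hs0.ne'
    have hgv : g (s, φ) ≠ v := by
      simp [g, hsC, hne, Complex.exp_ne_zero]
    have hball : g (s, φ) ∈ Metric.ball v r := by
      have : ‖Complex.exp (-(φ * Complex.I))‖ = 1 := by
        have := Complex.norm_exp_ofReal_mul_I (-φ)
        simpa using this
      rw [Metric.mem_ball, dist_eq_norm]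
      simp only [g, add_sub_cancel_left, norm_mul, this, mul_one, Complex.norm_real,
        Real.norm_eq_abs, abs_of_pos hs0]
      rwa [hρ, lt_div_iff₀ (norm_pos_iff.2 hne)] at hs1
    rcases hb hball hz with h | ⟨x, hx, hzx⟩
    · exact hgv h
    · obtain ⟨t, ht0, -, ht⟩ := exists_sub_eq_of_mem_segment hzx hgv
      have htC : (t : ℂ) ≠ 0 := by exact_mod_cast ht0.ne'
      have hxv : x - v = ((s / t : ℝ) : ℂ) * (u - v) * Complex.exp (-(φ * Complex.I)) := by
        simp only [g, add_sub_cancel_left] at ht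
        push_cast
        field_simp
        linear_combination -ht
      have h1 := hmin x hx
      rw [hxv, cwAngle_rotate hne (div_pos hs0 ht0) hφ0 (by linarith)] at h1
      linarith
  -- a rotation by a small angle leads from the arriving edge to its left
  have hside1 : ∀ s φ : ℝ, side u v (g (s, φ)) = s * Real.sin φ := by
    intro s φ
    have : (g (s, φ) - u) / (v - u) = 1 - s * Complex.exp (-(φ * Complex.I)) := by
      have hvu : v - u ≠ 0 := sub_ne_zero.2 huv.ne'
      simp only [g]
      field_simp
      ring
    have he : -((φ : ℂ) * Complex.I) = ((-φ : ℝ) : ℂ) * Complex.I := by push_cast; ring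
    rw [side, this, he, Complex.sub_im, Complex.im_ofReal_mul, Complex.exp_ofReal_mul_I_im,
      Real.sin_neg, Complex.one_im]
    ring
  have hside2 : ∀ s φ : ℝ, side v w (g (s, φ)) = s / c * Real.sin (θ - φ) := by
    intro s φ
    have hcC : (c : ℂ) ≠ 0 := by exact_mod_cast hc.ne'
    have : (g (s, φ) - v) / (w - v)
        = ((s / c : ℝ) : ℂ) * Complex.exp (((θ - φ : ℝ) : ℂ) * Complex.I) := by
      have he : Complex.exp (((θ - φ : ℝ) : ℂ) * Complex.I)
          = Complex.exp (-(φ * Complex.I)) * (Complex.exp (-(θ * Complex.I)))⁻¹ := by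
        rw [← Complex.exp_neg, ← Complex.exp_add]
        congr 1
        push_cast
        ring
      have h0 := Complex.exp_ne_zero (-(θ * Complex.I))
      rw [he, hcw]
      simp only [g, add_sub_cancel_left]
      push_cast
      field_simp
    rw [side, this, Complex.im_ofReal_mul, Complex.exp_ofReal_mul_I_im]
  have hTF : T ⊆ F := by
    refine hF.subset_of_isPreconnected hT hTs ?_
    set s : ℝ := min (ρ / 2) (1 / 2) with hs
    have hs0 : 0 < s := lt_min (by positivity) (by norm_num)
    have hs1 : s < 1 := (min_le_right _ _).trans_lt (by norm_num)
    have hs2 : s < ρ := (min_le_left _ _).trans_lt (by linarith)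
    have hg0 : g (s, 0) ∈ openSegment ℝ u v := by
      rw [openSegment_symm]
      exact mem_openSegment_iff.2 ⟨s, hs0, hs1, by simp [g]⟩
    have htend : Tendsto (fun φ : ℝ => g (s, φ)) (𝓝[>] 0) (𝓝 (g (s, 0))) :=
      ((hg.comp (Continuous.prodMk_right s)).tendsto 0).mono_left nhdsWithin_le_nhds
    obtain ⟨φ, h1, h2, h3⟩ := ((htend.eventually (hd _ hg0)).and
      ((Ioo_mem_nhdsGT hθ0 : Ioo 0 θ ∈ 𝓝[>] (0 : ℝ)) |> fun h => Filter.Eventually.and h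
        (Ioo_mem_nhdsGT Real.pi_pos))).exists
    refine ⟨g (s, φ), ⟨(s, φ), ⟨⟨hs0, hs2⟩, h2⟩, rfl⟩, h1 ?_⟩
    rw [hside1]
    exact mul_pos hs0 (Real.sin_pos_of_pos_of_lt_pi h3.1 h3.2)
  set s : ℝ := min (ρ / 2) (c / 2) with hs
  have hs0 : 0 < s := lt_min (by positivity) (by positivity)
  have hs1 : s < c := (min_le_right _ _).trans_lt (by linarith)
  have hs2 : s < ρ := (min_le_left _ _).trans_lt (by linarith)
  have hgθ : g (s, θ) ∈ openSegment ℝ v w := by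
    refine mem_openSegment_iff.2 ⟨s / c, by positivity, (div_lt_one hc).2 hs1, ?_⟩
    have hcC : (c : ℂ) ≠ 0 := by exact_mod_cast hc.ne'
    rw [hcw]
    simp only [g]
    push_cast
    field_simp
  have htend : Tendsto (fun φ : ℝ => g (s, φ)) (𝓝[<] θ) (𝓝 (g (s, θ))) :=
    ((hg.comp (Continuous.prodMk_right s)).tendsto θ).mono_left nhdsWithin_le_nhds
  refine hF.leftOf_of_frequently hvw hgθ (htend.frequently (Eventually.frequently ?_))
  filter_upwards [Ioo_mem_nhdsLT hθ0, Ioo_mem_nhdsLT (sub_lt_self θ Real.pi_pos)] with φ h1 h2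
  refine ⟨?_, hTF ⟨(s, φ), ⟨⟨hs0, hs2⟩, h1⟩, rfl⟩⟩
  change 0 < side v w _
  rw [hside2]
  exact mul_pos (div_pos hs0 hc)
    (Real.sin_pos_of_pos_of_lt_pi (by linarith [h1.2]) (by linarith [h2.1]))

end PSLG

/-! ### Winding numbers around a cell -/

namespace PSLG

variable {G : PSLG} {F : Set ℂ} {S : Multiset (ℂ × ℂ)}

/-- A cell of the graph: a bounded connected region that no edge has on both of its sides. -/
structure IsCell (G : PSLG) (F : Set ℂ) : Prop extends IsRegion G F where
  isConnected : IsConnected F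
  isBounded : Bornology.IsBounded F
  not_both : ∀ u v, G.graph.Adj u v → LeftOf F u v → ¬ LeftOf F v u

/-- A balanced family of distinct directed edges that have the cell on their left. -/
structure IsBoundaryPart (G : PSLG) (F : Set ℂ) (S : Multiset (ℂ × ℂ)) : Prop where
  nodup : S.Nodup
  balanced : Balanced S
  adj : ∀ s ∈ S, G.graph.Adj s.1 s.2
  leftOf : ∀ s ∈ S, LeftOf F s.1 s.2

theorem IsBoundaryPart.carrier_subset_frontier (hS : G.IsBoundaryPart F S) (hF : G.IsRegion F) :
    carrier S ⊆ frontier F :=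
  iUnion₂_subset fun s hs => hF.segment_subset_frontier (hS.adj s hs) (hS.leftOf s hs)

theorem IsBoundaryPart.interior_carrier (hS : G.IsBoundaryPart F S) (hF : G.IsRegion F) :
    interior (carrier S) = ∅ := by
  refine subset_empty_iff.1 ((interior_mono (hS.carrier_subset_frontier hF)).trans ?_)
  rw [← frontier_compl, interior_frontier hF.isOpen.isClosed_compl]

theorem IsBoundaryPart.notMem_carrier (hS : G.IsBoundaryPart F S) (hF : G.IsRegion F) {p : ℂ}
    (hp : p ∈ F) : p ∉ carrier S := fun h =>
  hF.notMem p hp (hF.frontier_subset (hS.carrier_subset_frontier hF h))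

theorem IsBoundaryPart.notMem_carrier_erase (hS : G.IsBoundaryPart F S) (hF : G.IsCell F)
    {s : ℂ × ℂ} (hs : s ∈ S) {p : ℂ} (hp : p ∈ openSegment ℝ s.1 s.2) :
    p ∉ carrier (S.erase s) := by
  intro h
  obtain ⟨t, ht, hpt⟩ := mem_carrier.1 h
  obtain ⟨hne, ht⟩ := hS.nodup.mem_erase_iff.1 ht
  refine notMem_segment_of_mem_openSegment (hS.adj s hs) (hS.adj t ht) (fun he => ?_) hp hpt
  rcases Sym2.eq_iff.1 he with ⟨h1, h2⟩ | ⟨h1, h2⟩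
  · exact hne (Prod.ext h1.symm h2.symm)
  · refine hF.not_both _ _ (hS.adj s hs) (hS.leftOf s hs) ?_
    rw [h1, h2]
    exact hS.leftOf t ht

theorem IsBoundaryPart.exists_mem_openSegment (hS : G.IsBoundaryPart F S) {p : ℂ}
    (hp : p ∈ carrier S) (hv : p ∉ G.verts) : ∃ s ∈ S, p ∈ openSegment ℝ s.1 s.2 := by
  obtain ⟨s, hs, hps⟩ := mem_carrier.1 hp
  rw [← insert_endpoints_openSegment] at hps
  rcases hps with rfl | rfl | h
  · exact absurd (G.mem_verts _ _ (hS.adj s hs)) hv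
  · exact absurd (G.mem_verts _ _ (hS.adj s hs).symm) hv
  · exact ⟨s, hs, h⟩

theorem exists_eventually_nhds_of_cobounded {P : ℂ → Prop}
    (h : ∀ᶠ z in Bornology.cobounded ℂ, P z) : ∃ q, ∀ᶠ z in 𝓝 q, P z := by
  obtain ⟨R, -, hR⟩ := (Filter.hasBasis_cobounded_norm (E := ℂ)).mem_iff.1 h
  refine ⟨((|R| + 1 : ℝ) : ℂ), ?_⟩
  have : ∀ᶠ z in 𝓝 (((|R| + 1 : ℝ) : ℂ)), R < ‖z‖ := by
    refine continuous_norm.continuousAt.eventually_const_lt ?_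
    change R < ‖((|R| + 1 : ℝ) : ℂ)‖
    rw [Complex.norm_real, Real.norm_eq_abs]
    have := le_abs_self R
    have := le_abs_self (|R| + 1)
    linarith
  exact this.mono fun z hz => hR hz.le

/-- Far away from a cell, the edges along it have total angle zero. -/
theorem IsBoundaryPart.exists_outside (hS : G.IsBoundaryPart F S) (hF : G.IsCell F) :
    ∃ q, ∀ᶠ z in 𝓝 q, z ∉ carrier S ∧ z ∉ F ∧ totalAng S z = 0 := by
  have hcl : ∀ᶠ z in Bornology.cobounded ℂ, z ∉ closure F :=
    Bornology.isBounded_def.1 hF.isBounded.closure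
  have hc : ∀ᶠ z in Bornology.cobounded ℂ, z ∉ carrier S := hcl.mono fun z hz h =>
    hz (frontier_subset_closure (hS.carrier_subset_frontier hF.toIsRegion h))
  exact exists_eventually_nhds_of_cobounded (hc.and ((hcl.mono fun z hz h =>
    hz (subset_closure h)).and (eventually_totalAng_eq_zero hS.balanced hc)))

theorem IsBoundaryPart.exists_eq_on (hS : G.IsBoundaryPart F S) (hF : G.IsCell F) :
    ∃ c : ℤ, ∀ z ∈ F, totalAng S z = 2 * Real.pi * c := by
  obtain ⟨y, hy, h⟩ := hF.isConnected.isPreconnected.eqOn_const_of_mapsTo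
    (T := (AddSubgroup.zmultiples (2 * Real.pi) : Set ℝ)) (f := totalAng S)
    (hT := ⟨inferInstanceAs (DiscreteTopology (AddSubgroup.zmultiples (2 * Real.pi)))⟩)
    (fun z hz => (continuousAt_totalAng
      (hS.notMem_carrier hF.toIsRegion hz)).continuousWithinAt)
    (fun z hz => by
      obtain ⟨n, hn⟩ := exists_totalAng_eq hS.balanced (hS.notMem_carrier hF.toIsRegion hz)
      exact AddSubgroup.mem_zmultiples_iff.2 ⟨n, by rw [hn]; simp [mul_comm]⟩)
    ⟨0, AddSubgroup.zero_mem _⟩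
  obtain ⟨c, rfl⟩ := AddSubgroup.mem_zmultiples_iff.1 hy
  exact ⟨c, fun z hz => by rw [h hz]; simp [mul_comm]⟩

/-- The two sides of an inner point of an edge along the cell: on the left lies the cell, on the
right it does not, and the total angle drops by `2π` from the left to the right. -/
theorem IsBoundaryPart.exists_eventually (hS : G.IsBoundaryPart F S) (hF : G.IsCell F) {s : ℂ × ℂ}
    (hs : s ∈ S) {p : ℂ} (hp : p ∈ openSegment ℝ s.1 s.2) :
    ∃ n : ℤ, ∀ᶠ z in 𝓝 p, z ∉ carrier S →
      (z ∈ F ∧ totalAng S z = 2 * Real.pi * n) ∨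
      (z ∉ F ∧ totalAng S z = 2 * Real.pi * (n - 1 : ℤ)) := by
  have hadj := hS.adj s hs
  obtain ⟨n, hn⟩ := exists_jump hS.balanced hadj.ne hp hs (hS.notMem_carrier_erase hF hs hp)
  have hr := hF.eventually_notMem hadj.symm
    (hF.not_both _ _ hadj (hS.leftOf s hs)) (openSegment_symm ℝ s.1 s.2 ▸ hp)
  refine ⟨n, ?_⟩
  filter_upwards [hn, hS.leftOf s hs p hp, hr, eventually_mem_openSegment hadj.ne hp]
    with z h1 h2 h3 h4 hz
  rw [side_swap hadj.ne] at h3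
  rcases lt_trichotomy (side s.1 s.2 z) 0 with h | h | h
  · exact .inr ⟨h3 (by linarith), h1.2 h⟩
  · exact absurd (mem_carrier.2 ⟨s, hs, openSegment_subset_segment ℝ _ _ (h4 h)⟩) hz
  · exact .inl ⟨h2 h, h1.1 h⟩

theorem IsBoundaryPart.exists_notMem_verts (hS : G.IsBoundaryPart F S) (hne : S ≠ 0) :
    ∃ s ∈ S, ∃ p ∈ openSegment ℝ s.1 s.2, p ∉ G.verts := by
  obtain ⟨s, hs⟩ := Multiset.exists_mem_of_ne_zero hne
  have hp : s.1 + ((1 / 2 : ℝ) : ℂ) * (s.2 - s.1) ∈ openSegment ℝ s.1 s.2 :=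
    mem_openSegment_iff.2 ⟨1 / 2, by norm_num, by norm_num, rfl⟩
  exact ⟨s, hs, _, hp, fun hv => G.vertex_notMem _ _ _ (hS.adj s hs) hv hp⟩

/-- A balanced part of the boundary of a cell winds either once counterclockwise around the cell,
or clockwise around a part of the outside of the cell. Indeed its winding number takes the
value `c` of the cell to the left of each of its edges and hence the value `c - 1` to the right, so
these are the only values; as one of them is the value `0` far away, `c = 0` or `c = 1`. -/
theorem IsBoundaryPart.totalAng_values (hS : G.IsBoundaryPart F S) (hF : G.IsCell F) (hne : S ≠ 0) :
    ((∀ p ∉ carrier S, totalAng S p = 0 ∨ totalAng S p = 2 * Real.pi) ∧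
      ∀ p ∈ F, totalAng S p = 2 * Real.pi) ∨
    ((∀ p ∉ carrier S, totalAng S p = 0 ∨ totalAng S p = -(2 * Real.pi)) ∧
      ∀ p ∈ F, totalAng S p = 0) := by
  obtain ⟨c, hc⟩ := hS.exists_eq_on hF
  have hedge : ∀ s ∈ S, ∀ p ∈ openSegment ℝ s.1 s.2, ∀ᶠ z in 𝓝 p, z ∉ carrier S →
      totalAng S z = 2 * Real.pi * c ∨ totalAng S z = 2 * Real.pi * (c - 1 : ℤ) := by
    intro s hs p hp
    obtain ⟨n, hn⟩ := hS.exists_eventually hF hs hp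
    have hnc : n = c := by
      obtain ⟨z, hz, h1, h2⟩ := ((frequently_side_pos (hS.adj s hs).ne hp).and_eventually
        (hn.and (hS.leftOf s hs p hp))).exists
      rcases h1 (hS.notMem_carrier hF.toIsRegion (h2 hz)) with h | h
      · exact two_pi_mul_int_inj (h.2.symm.trans (hc z h.1))
      · exact absurd (h2 hz) h.1
    subst hnc
    exact hn.mono fun z h hz => (h hz).imp And.right And.right
  have hall : ∀ p ∉ carrier S,
      totalAng S p = 2 * Real.pi * c ∨ totalAng S p = 2 * Real.pi * (c - 1 : ℤ) := by
    intro p hp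
    refine forall_of_propagates (V := {p | p ∈ G.verts ∧ p ∈ carrier S})
      (Q := fun p => totalAng S p = 2 * Real.pi * c ∨ totalAng S p = 2 * Real.pi * (c - 1 : ℤ))
      (hS.interior_carrier hF.toIsRegion)
      (G.verts.finite_toSet.subset fun z hz => hz.1) (fun z hz => hz.2) (fun q hq => ?_) ?_ hp
    · by_cases hqS : q ∈ carrier S
      · obtain ⟨s, hs, hqs⟩ := hS.exists_mem_openSegment hqS fun hv => hq ⟨hv, hqS⟩
        exact .inl (hedge s hs q hqs)
      · obtain ⟨n, -, hn⟩ := eventually_totalAng_eq hS.balanced hqS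
        by_cases hQ : 2 * Real.pi * (n : ℝ) = 2 * Real.pi * c ∨
            2 * Real.pi * (n : ℝ) = 2 * Real.pi * (c - 1 : ℤ)
        · exact .inl (hn.mono fun z hz _ => by rwa [hz])
        · exact .inr (hn.mono fun z hz _ => by rwa [hz])
    · obtain ⟨s, hs, p, hp, hpv⟩ := hS.exists_notMem_verts hne
      exact ⟨p, fun h => hpv h.1, hedge s hs p hp⟩
  obtain ⟨q, hq⟩ := hS.exists_outside hF
  obtain ⟨hq1, -, hq0⟩ := hq.self_of_nhds
  have hzero : (0 : ℝ) = 2 * Real.pi * ((0 : ℤ) : ℝ) := by simp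
  rcases hall q hq1 with h | h
  · obtain rfl : 0 = c := two_pi_mul_int_inj (by rw [← hzero, ← hq0, h])
    refine .inr ⟨fun p hp => (hall p hp).imp ?_ ?_, fun p hp => ?_⟩
    · intro h; simpa using h
    · intro h; simpa using h
    · simpa using hc p hp
  · obtain rfl : c = 1 := by
      have : 0 = c - 1 := two_pi_mul_int_inj (by rw [← hzero, ← hq0, h])
      linarith
    refine .inl ⟨fun p hp => (hall p hp).symm.imp ?_ ?_, fun p hp => ?_⟩
    · intro h; simpa using h
    · intro h; simpa using h
    · simpa using hc p hp

/-- The whole boundary of a cell has winding number `1` around the points of the cell and `0`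
around all others: the difference of the two sides has no jump at the edges, and vanishes far
away. -/
theorem IsBoundaryPart.totalAng_eq (hS : G.IsBoundaryPart F S) (hF : G.IsCell F)
    (hfr : carrier S = frontier F) {p : ℂ} (hp : p ∉ carrier S) :
    (p ∈ F → totalAng S p = 2 * Real.pi) ∧ (p ∉ F → totalAng S p = 0) := by
  refine forall_of_propagates (V := {p | p ∈ G.verts ∧ p ∈ carrier S})
    (Q := fun p => (p ∈ F → totalAng S p = 2 * Real.pi) ∧ (p ∉ F → totalAng S p = 0))
    (hS.interior_carrier hF.toIsRegion)
    (G.verts.finite_toSet.subset fun z hz => hz.1) (fun z hz => hz.2) (fun q hq => ?_) ?_ hp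
  · by_cases hqS : q ∈ carrier S
    · obtain ⟨s, hs, hqs⟩ := hS.exists_mem_openSegment hqS fun hv => hq ⟨hv, hqS⟩
      obtain ⟨n, hn⟩ := hS.exists_eventually hF hs hqs
      by_cases h1 : n = 1
      · subst h1
        refine .inl (hn.mono fun z hz hzS => ?_)
        rcases hz hzS with ⟨h, h'⟩ | ⟨h, h'⟩
        · exact ⟨fun _ => by simpa using h', fun h0 => absurd h h0⟩
        · exact ⟨fun h0 => absurd h0 h, fun _ => by simpa using h'⟩
      · refine .inr (hn.mono fun z hz hzS hQ => h1 ?_)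
        rcases hz hzS with ⟨h, h'⟩ | ⟨h, h'⟩
        · refine two_pi_mul_int_inj ?_
          rw [← h', hQ.1 h]
          simp
        · have : n - 1 = 0 := two_pi_mul_int_inj (by rw [← h', hQ.2 h]; simp)
          linarith
    · obtain ⟨n, -, hn⟩ := eventually_totalAng_eq hS.balanced hqS
      have hdich : (∀ᶠ z in 𝓝 q, z ∈ F) ∨ ∀ᶠ z in 𝓝 q, z ∉ F := by
        rw [hfr, frontier, Set.mem_sdiff, not_and, not_not] at hqS
        by_cases hqF : q ∈ closure F
        · exact .inl (mem_interior_iff_mem_nhds.1 (hqS hqF))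
        · exact .inr (Filter.mem_of_superset (isClosed_closure.isOpen_compl.mem_nhds hqF)
            fun z hz h => hz (subset_closure h))
      rcases hdich with hd | hd
      · by_cases hQ : 2 * Real.pi * (n : ℝ) = 2 * Real.pi
        · exact .inl ((hd.and hn).mono fun z hz _ =>
            ⟨fun _ => hz.2.trans hQ, fun h => absurd hz.1 h⟩)
        · exact .inr ((hd.and hn).mono fun z hz _ h => hQ (hz.2.symm.trans (h.1 hz.1)))
      · by_cases hQ : 2 * Real.pi * (n : ℝ) = 0
        · exact .inl ((hd.and hn).mono fun z hz _ =>
            ⟨fun h => absurd h hz.1, fun _ => hz.2.trans hQ⟩)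
        · exact .inr ((hd.and hn).mono fun z hz _ h => hQ (hz.2.symm.trans (h.2 hz.1)))
  · obtain ⟨q, hq⟩ := hS.exists_outside hF
    exact ⟨q, fun h => hq.self_of_nhds.1 h.2, hq.mono fun z hz _ =>
      ⟨fun h => absurd h hz.2.1, fun _ => hz.2.2⟩⟩

end PSLG

/-! ### Cutting closed rings into simple ones -/

namespace Ring

theorem mem_toMultiset {α : Type*} {c : Cycle α} {s : α} : s ∈ c.toMultiset ↔ s ∈ c := by
  induction c using Quotient.inductionOn with
  | _ l => simp

theorem boundary_eq (c : Ring) : c.boundary = carrier c.toMultiset := by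
  simp [boundary, carrier, mem_toMultiset]

theorem winding_eq (c : Ring) (p : ℂ) : c.winding p = totalAng c.toMultiset p / (2 * Real.pi) :=
  rfl

theorem balanced_of_closed {c : Ring} (hc : c.Closed) : Balanced c.toMultiset := by
  have key : ∀ (l : List (ℂ × ℂ)) (a b : ℂ × ℂ),
      List.IsChain (fun s t : ℂ × ℂ => s.2 = t.1) (a :: (l ++ [b])) →
        (a :: l).map Prod.snd = (l ++ [b]).map Prod.fst := by
    intro l
    induction l with
    | nil => simp
    | cons x l ih =>
      intro a b h
      rw [List.cons_append, List.isChain_cons_cons] at h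
      have := ih x b h.2
      simp only [List.map_cons, List.map_append, List.cons_append] at this ⊢
      rw [h.1, this]
  induction c using Quotient.inductionOn with
  | _ l =>
    cases l with
    | nil => rfl
    | cons a l =>
      have h := key l a a hc
      change Multiset.map Prod.fst ((a :: l : List (ℂ × ℂ)) : Multiset (ℂ × ℂ))
        = Multiset.map Prod.snd ((a :: l : List (ℂ × ℂ)) : Multiset (ℂ × ℂ))
      rw [Multiset.map_coe, Multiset.map_coe, h, Multiset.coe_eq_coe]
      simpa using! (List.perm_append_comm (l₁ := [a.1]) (l₂ := l.map Prod.fst))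

theorem exists_split_of_not_nodup {α β : Type*} (f : α → β) (l : List α) (h : ¬ (l.map f).Nodup) :
    ∃ x a y b z, l = x ++ a :: (y ++ b :: z) ∧ f a = f b := by
  induction l with
  | nil => simp at h
  | cons a l ih =>
    by_cases hl : (l.map f).Nodup
    · rw [List.map_cons, List.nodup_cons, not_and_or, not_not] at h
      rcases h with h | h
      · obtain ⟨b, hb, hab⟩ := List.mem_map.1 h
        obtain ⟨y, z, rfl⟩ := List.append_of_mem hb
        exact ⟨[], a, y, b, z, rfl, hab.symm⟩
      · exact absurd hl h
    · obtain ⟨x, a', y, b, z, rfl, hab⟩ := ih hl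
      exact ⟨a :: x, a', y, b, z, rfl, hab⟩

/-- A closed ring can be cut, at the vertices that it visits repeatedly, into closed rings that
visit no vertex twice. -/
theorem exists_parts (c : Ring) (hc : c.Closed) : ∃ parts : Multiset Ring,
    (parts.map Cycle.toMultiset).sum = c.toMultiset ∧
      ∀ r ∈ parts, r.Closed ∧ r ≠ Cycle.nil ∧ (r.map Prod.fst).Nodup := by
  induction hn : c.length using Nat.strong_induction_on generalizing c with
  | _ n ih =>
  induction c using Quotient.inductionOn with
  | _ l =>
  change Closed ((l : List (ℂ × ℂ)) : Ring) at hc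
  change l.length = n at hn
  change ∃ parts : Multiset Ring, (parts.map Cycle.toMultiset).sum = (l : Ring).toMultiset ∧ _
  by_cases hnil : l = []
  · subst hnil
    exact ⟨0, by simp, by simp⟩
  by_cases hl : (l.map Prod.fst).Nodup
  · refine ⟨{(l : Ring)}, by simp, fun r hr => ?_⟩
    rw [Multiset.mem_singleton] at hr
    subst hr
    exact ⟨hc, by simpa using hnil, by simpa using hl⟩
  · obtain ⟨x, a, y, b, z, rfl, hab⟩ := exists_split_of_not_nodup Prod.fst l hl
    have hrot : ((x ++ a :: (y ++ b :: z) : List (ℂ × ℂ)) : Ring)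
        = ((a :: (y ++ b :: (z ++ x)) : List (ℂ × ℂ)) : Ring) := by
      rw [Cycle.coe_eq_coe]
      convert! List.isRotated_append (l := x) (l' := a :: (y ++ b :: z)) using 1
      simp
    rw [hrot] at hc ⊢
    have hchain : List.IsChain (fun s t : ℂ × ℂ => s.2 = t.1)
        ((a :: y) ++ b :: ((z ++ x) ++ [a])) := by
      simpa [Closed] using hc
    rw [List.isChain_split] at hchain
    -- the last segment of each of the two pieces ends in the common start of `a` and `b`
    have hend : ∀ (m : List (ℂ × ℂ)) (s t : ℂ × ℂ), s.1 = t.1 →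
        List.IsChain (fun s t : ℂ × ℂ => s.2 = t.1) (m ++ [s]) →
        List.IsChain (fun s t : ℂ × ℂ => s.2 = t.1) (m ++ [t]) := by
      intro m s t hst h
      rw [List.isChain_append] at h ⊢
      refine ⟨h.1, by simp, fun x hx y hy => ?_⟩
      simp only [List.head?_cons, Option.mem_def, Option.some.injEq] at hy
      subst hy
      rw [← hst]
      exact h.2.2 x hx s (by simp)
    have h1 : Closed ((a :: y : List (ℂ × ℂ)) : Ring) := hend (a :: y) b a hab.symm hchain.1
    have h2 : Closed ((b :: (z ++ x) : List (ℂ × ℂ)) : Ring) :=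
      hend (b :: (z ++ x)) a b hab hchain.2
    obtain ⟨p1, hs1, hp1⟩ := ih _ (by
      simp only [Cycle.length_coe, List.length_cons, List.length_append] at hn ⊢
      omega) _ h1 rfl
    obtain ⟨p2, hs2, hp2⟩ := ih _ (by
      simp only [Cycle.length_coe, List.length_cons, List.length_append] at hn ⊢
      omega) _ h2 rfl
    refine ⟨p1 + p2, ?_, fun r hr => (Multiset.mem_add.1 hr).elim (hp1 r) (hp2 r)⟩
    rw [Multiset.map_add, Multiset.sum_add, hs1, hs2]
    exact Multiset.coe_add _ _

/-- A nonempty closed ring that neither contains a degenerate segment nor two opposite ones has at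
least three sides. -/
theorem three_le_length {c : Ring} (hc : c.Closed) (hne : c ≠ Cycle.nil)
    (h : ∀ s ∈ c, s.1 ≠ s.2 ∧ s.swap ∉ c) : 3 ≤ c.length := by
  induction c using Quotient.inductionOn with
  | _ l =>
  change Closed ((l : List (ℂ × ℂ)) : Ring) at hc
  change (l : Ring) ≠ Cycle.nil at hne
  change ∀ s ∈ (l : Ring), s.1 ≠ s.2 ∧ s.swap ∉ (l : Ring) at h
  change 3 ≤ l.length
  match l, hc, hne, h with
  | [], _, hne, _ => exact absurd rfl hne
  | [a], hc, _, h =>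
    have hc : a.2 = a.1 := by simpa [Closed] using! hc
    exact absurd hc.symm (h a (by simp)).1
  | [a, b], hc, _, h =>
    have hc : a.2 = b.1 ∧ b.2 = a.1 := by simpa [Closed] using! hc
    exact absurd (show a.swap ∈ (([a, b] : List (ℂ × ℂ)) : Ring) by
      simp [Prod.ext_iff, hc.1, hc.2]) (h a (by simp)).2
  | a :: b :: c :: l, _, _, _ => simp

/-- If the winding numbers of outer rings and rings of holes around a point of the polygon are `1`
and `0`, and the total winding number there is `1`, then exactly one ring is an outer ring. -/
theorem exists_unique_outer (T : Multiset Ring) (f : Ring → ℝ)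
    (hT : ∀ c ∈ T, (IsOuter c ∧ f c = 1) ∨ (IsHole c ∧ f c = 0)) (hsum : (T.map f).sum = 1) :
    ∃ outer holes, T = outer ::ₘ holes ∧ IsOuter outer ∧ ∀ h ∈ holes, IsHole h := by
  have hex : ∃ c ∈ T, IsOuter c ∧ f c = 1 := by
    by_contra! hn
    have : (T.map f).sum = 0 := Multiset.sum_eq_zero fun x hx => by
      obtain ⟨c, hc, rfl⟩ := Multiset.mem_map.1 hx
      exact ((hT c hc).resolve_left fun h => hn c hc h.1 h.2).2
    linarith
  obtain ⟨c, hc, hout, hfc⟩ := hex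
  obtain ⟨T', rfl⟩ := Multiset.exists_cons_of_mem hc
  refine ⟨c, T', rfl, hout, fun d hd => ?_⟩
  refine ((hT d (Multiset.mem_cons_of_mem hd)).resolve_left fun h => ?_).1
  obtain ⟨T'', rfl⟩ := Multiset.exists_cons_of_mem hd
  have hnn : 0 ≤ (T''.map f).sum := Multiset.sum_nonneg fun x hx => by
    obtain ⟨e, he, rfl⟩ := Multiset.mem_map.1 hx
    rcases hT e (by simp [he]) with h | h
    · rw [h.2]; exact zero_le_one
    · rw [h.2]
  simp only [Multiset.map_cons, Multiset.sum_cons] at hsum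
  linarith [h.2]

end Ring

theorem totalAng_multiset_sum (T : Multiset (Multiset (ℂ × ℂ))) (p : ℂ) :
    totalAng T.sum p = (T.map fun S => totalAng S p).sum := by
  induction T using Multiset.induction_on with
  | empty => simp [totalAng]
  | cons S T ih => simp [totalAng_add, ih]

theorem totalAng_finset_sum {ι : Type*} (T : Finset ι) (f : ι → Multiset (ℂ × ℂ)) (p : ℂ) :
    totalAng (∑ i ∈ T, f i) p = ∑ i ∈ T, totalAng (f i) p := by
  rw [Finset.sum, totalAng_multiset_sum, Multiset.map_map]
  rfl

theorem LabelledPolygon.winding_eq_totalAng {C : Type*} (P : LabelledPolygon C) (p : ℂ) :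
    P.winding p = totalAng P.sides p / (2 * Real.pi) := by
  rw [sides, totalAng_finset_sum, Finset.sum_div]
  rfl

theorem LabelledPolygon.balanced_sides {C : Type*} (P : LabelledPolygon C)
    (h : ∀ r ∈ P.rings, Ring.Closed r) : Balanced P.sides := by
  have e : ∀ f : ℂ × ℂ → ℂ, P.sides.map f = ∑ r ∈ P.rings, r.toMultiset.map f := fun f =>
    map_sum (Multiset.mapAddMonoidHom f) _ _
  rw [Balanced, e, e]
  exact Finset.sum_congr rfl fun r hr => Ring.balanced_of_closed (h r hr)

/-! ### The rings traced from the edges of a graph -/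

namespace PSLG

variable {G : PSLG}

theorem mem_periodicPts_next (d : G.graph.Dart) : d ∈ Function.periodicPts G.next :=
  next_injective.mem_periodicPts d

theorem mem_tracedRing {d : G.graph.Dart} {s : ℂ × ℂ} :
    s ∈ G.tracedRing d ↔ ∃ n, (G.next^[n] d).toProd = s := by
  simp only [tracedRing, Cycle.mem_map, Function.mem_periodicOrbit_iff (mem_periodicPts_next d)]
  constructor
  · rintro ⟨_, ⟨n, rfl⟩, rfl⟩
    exact ⟨n, rfl⟩
  · rintro ⟨n, rfl⟩
    exact ⟨_, ⟨n, rfl⟩, rfl⟩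

theorem self_mem_tracedRing (d : G.graph.Dart) : d.toProd ∈ G.tracedRing d :=
  mem_tracedRing.2 ⟨0, rfl⟩

theorem tracedRing_eq {d e : G.graph.Dart} (h : e.toProd ∈ G.tracedRing d) :
    G.tracedRing d = G.tracedRing e := by
  obtain ⟨n, hn⟩ := mem_tracedRing.1 h
  obtain rfl : G.next^[n] d = e := SimpleGraph.Dart.ext _ _ hn
  rw [tracedRing, tracedRing, Function.periodicOrbit_apply_iterate_eq (mem_periodicPts_next d)]

theorem closed_tracedRing (d : G.graph.Dart) : (G.tracedRing d).Closed := by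
  rw [Ring.Closed, tracedRing, Cycle.chain_map,
    Function.periodicOrbit_chain' _ (mem_periodicPts_next d)]
  intro n
  rw [Function.iterate_succ_apply']
  rfl

theorem nodup_tracedRing (d : G.graph.Dart) : (G.tracedRing d).toMultiset.Nodup := by
  have h : (Function.periodicOrbit G.next d).Nodup := Function.nodup_periodicOrbit
  rw [tracedRing]
  generalize Function.periodicOrbit G.next d = c at h
  induction c using Quotient.inductionOn with
  | _ l =>
    have h : l.Nodup := h
    exact Multiset.coe_nodup.2 (h.map fun a b hab => SimpleGraph.Dart.ext _ _ hab)

theorem properlyMeet {s t : ℂ × ℂ} (hs : G.graph.Adj s.1 s.2) (ht : G.graph.Adj t.1 t.2) :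
    ProperlyMeet s t := by
  by_cases he : s(s.1, s.2) = s(t.1, t.2)
  · rcases Sym2.eq_iff.1 he with ⟨h1, h2⟩ | ⟨h1, h2⟩
    · exact .inl (Prod.ext h1 h2)
    · exact .inr (.inl (Prod.ext h1 h2))
  · refine .inr (.inr fun p ⟨hps, hpt⟩ => ⟨?_, ?_⟩)
    · by_contra hn
      have : p ∈ openSegment ℝ s.1 s.2 :=
        (mem_insert_iff.1 (insert_endpoints_openSegment ℝ s.1 s.2 ▸ hps)).elim
          (fun h => absurd (.inl h) hn) fun h => h.elim (fun h => absurd (.inr h) hn) id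
      exact notMem_segment_of_mem_openSegment hs ht he this hpt
    · by_contra hn
      have : p ∈ openSegment ℝ t.1 t.2 :=
        (mem_insert_iff.1 (insert_endpoints_openSegment ℝ t.1 t.2 ▸ hpt)).elim
          (fun h => absurd (.inl h) hn) fun h => h.elim (fun h => absurd (.inr h) hn) id
      exact notMem_segment_of_mem_openSegment ht hs (Ne.symm he) this hps

/-! ### The polygon traced for a face -/

variable {Ω : Set ℂ} {C : Type*} {M : ℂ → C}

theorem Face.isLeftOf_iff {F : G.Face Ω} (hF : G.IsRegion F.1) {u v : ℂ} (h : G.graph.Adj u v) :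
    F.IsLeftOf u v ↔ LeftOf F.1 u v := by
  constructor
  · intro hl
    have hp : u + ((1 / 2 : ℝ) : ℂ) * (v - u) ∈ openSegment ℝ u v :=
      mem_openSegment_iff.2 ⟨1 / 2, by norm_num, by norm_num, rfl⟩
    refine hF.leftOf_of_frequently h hp
      ((tendsto_add_normal u v _).frequently (Eventually.frequently ?_))
    filter_upwards [hl _ hp, self_mem_nhdsWithin] with t ht h0
    exact ⟨by rwa [side_add h.ne hp], ht⟩
  · intro hl p hp
    filter_upwards [(tendsto_add_normal u v p).eventually (hl p hp), self_mem_nhdsWithin]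
      with t ht h0
    exact ht (by rwa [side_add h.ne hp])

theorem mem_rings_traced {F : G.Face Ω} {r : Ring} :
    r ∈ (F.traced M).rings ↔ ∃ d : G.graph.Dart, F.IsLeftOf d.fst d.snd ∧ G.tracedRing d = r := by
  simp [Face.traced]

theorem mem_sides {P : LabelledPolygon C} {s : ℂ × ℂ} : s ∈ P.sides ↔ ∃ r ∈ P.rings, s ∈ r := by
  simp [LabelledPolygon.sides, Multiset.mem_sum, Ring.mem_toMultiset]

/-- The sides of the polygon traced for a face are the directed edges with the face on their
left. -/
theorem mem_sides_traced {F : G.Face Ω} (hF : G.IsRegion F.1) {s : ℂ × ℂ} :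
    s ∈ (F.traced M).sides ↔ G.graph.Adj s.1 s.2 ∧ LeftOf F.1 s.1 s.2 := by
  rw [mem_sides]
  constructor
  · rintro ⟨r, hr, hs⟩
    obtain ⟨d, hd, rfl⟩ := mem_rings_traced.1 hr
    obtain ⟨n, rfl⟩ := mem_tracedRing.1 hs
    have hl : ∀ n, LeftOf F.1 (G.next^[n] d).fst (G.next^[n] d).snd := by
      intro n
      induction n with
      | zero => exact (Face.isLeftOf_iff hF d.adj).1 hd
      | succ n ih =>
        rw [Function.iterate_succ_apply']
        exact hF.leftOf_next ih
    exact ⟨(G.next^[n] d).adj, hl n⟩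
  · rintro ⟨h, hl⟩
    exact ⟨_, mem_rings_traced.2 ⟨⟨s, h⟩, (Face.isLeftOf_iff hF h).2 hl, rfl⟩,
      self_mem_tracedRing ⟨s, h⟩⟩

theorem closed_of_mem_rings {F : G.Face Ω} {r : Ring} (hr : r ∈ (F.traced M).rings) :
    r.Closed := by
  obtain ⟨d, -, rfl⟩ := mem_rings_traced.1 hr
  exact closed_tracedRing d

theorem nodup_sides_traced (F : G.Face Ω) : (F.traced M).sides.Nodup := by
  classical
  rw [Multiset.nodup_iff_count_le_one]
  intro s
  rw [LabelledPolygon.sides, Multiset.count_sum']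
  by_cases hs : ∃ r ∈ (F.traced M).rings, s ∈ r
  · obtain ⟨r, hr, hsr⟩ := hs
    rw [Finset.sum_eq_single_of_mem r hr]
    · obtain ⟨d, -, rfl⟩ := mem_rings_traced.1 hr
      exact Multiset.nodup_iff_count_le_one.1 (nodup_tracedRing d) s
    · intro r' hr' hne
      refine Multiset.count_eq_zero_of_notMem fun hsr' => hne ?_
      rw [Ring.mem_toMultiset] at hsr'
      obtain ⟨d, -, rfl⟩ := mem_rings_traced.1 hr
      obtain ⟨d', -, rfl⟩ := mem_rings_traced.1 hr'
      obtain ⟨n, rfl⟩ := mem_tracedRing.1 hsr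
      rw [tracedRing_eq hsr, tracedRing_eq hsr']
  · rw [Finset.sum_eq_zero]
    · exact zero_le_one
    · intro r hr
      exact Multiset.count_eq_zero_of_notMem fun h => hs ⟨r, hr, Ring.mem_toMultiset.1 h⟩

theorem isBoundaryPart_traced {F : G.Face Ω} (hF : G.IsCell F.1) :
    G.IsBoundaryPart F.1 (F.traced M).sides where
  nodup := nodup_sides_traced F
  balanced := LabelledPolygon.balanced_sides _ fun _ hr => closed_of_mem_rings hr
  adj _ hs := ((mem_sides_traced hF.toIsRegion).1 hs).1
  leftOf _ hs := ((mem_sides_traced hF.toIsRegion).1 hs).2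

theorem boundary_traced {F : G.Face Ω} (hF : G.IsCell F.1)
    (hdeg : ∀ v ∈ G.verts, ∃ w, G.graph.Adj v w) :
    (F.traced M).boundary = frontier F.1 := by
  rw [hF.frontier_eq hdeg]
  ext p
  simp only [LabelledPolygon.boundary, mem_iUnion, exists_prop, mem_sides_traced hF.toIsRegion]
  exact ⟨fun ⟨s, hs, hp⟩ => ⟨⟨s, hs.1⟩, hs.2, hp⟩, fun ⟨d, hd, hp⟩ => ⟨d.toProd, ⟨d.adj, hd⟩, hp⟩⟩

theorem winding_traced {F : G.Face Ω} (hF : G.IsCell F.1)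
    (hdeg : ∀ v ∈ G.verts, ∃ w, G.graph.Adj v w) {p : ℂ} (hp : p ∉ (F.traced M).boundary) :
    (p ∈ F.1 → (F.traced M).winding p = 1) ∧ (p ∉ F.1 → (F.traced M).winding p = 0) := by
  have h := (isBoundaryPart_traced (M := M) hF).totalAng_eq hF (boundary_traced hF hdeg) hp
  rw [LabelledPolygon.winding_eq_totalAng]
  refine ⟨fun hpF => ?_, fun hpF => ?_⟩
  · rw [h.1 hpF, div_self Real.two_pi_pos.ne']
  · rw [h.2 hpF, zero_div]

theorem inside_traced {F : G.Face Ω} (hF : G.IsCell F.1)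
    (hdeg : ∀ v ∈ G.verts, ∃ w, G.graph.Adj v w) : (F.traced M).inside = F.1 := by
  ext p
  constructor
  · rintro ⟨hp, hw⟩
    by_contra hpF
    exact hw ((winding_traced hF hdeg hp).2 hpF)
  · intro hpF
    have hp : p ∉ (F.traced M).boundary :=
      (isBoundaryPart_traced (M := M) hF).notMem_carrier hF.toIsRegion hpF
    exact ⟨hp, by rw [(winding_traced hF hdeg hp).1 hpF]; exact one_ne_zero⟩

/-- A simple ring made of edges along a cell is an outer ring that winds once around the cell, or
the ring of a hole that does not wind around the cell. -/
theorem IsBoundaryPart.isOuter_or_isHole {F : Set ℂ} (hF : G.IsCell F) {c : Ring}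
    (hc : G.IsBoundaryPart F c.toMultiset) (hs : c.Simple) {p : ℂ} (hp : p ∈ F) :
    (c.IsOuter ∧ c.winding p = 1) ∨ (c.IsHole ∧ c.winding p = 0) := by
  have hne : c.toMultiset ≠ 0 := by
    rw [Ne, Cycle.toMultiset_eq_nil]
    rintro rfl
    simpa using hs.three_le
  have hpi := Real.two_pi_pos.ne'
  simp only [Ring.IsOuter, Ring.IsHole, Ring.boundary_eq, Ring.winding_eq]
  rcases hc.totalAng_values hF hne with ⟨h, h'⟩ | ⟨h, h'⟩
  · refine .inl ⟨⟨hs, fun q hq => (h q hq).imp (fun e => ?_) fun e => ?_⟩, ?_⟩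
    · rw [e, zero_div]
    · rw [e, div_self hpi]
    · rw [h' p hp, div_self hpi]
  · refine .inr ⟨⟨hs, fun q hq => (h q hq).imp (fun e => ?_) fun e => ?_⟩, ?_⟩
    · rw [e, zero_div]
    · rw [e, neg_div, div_self hpi]
    · rw [h' p hp, zero_div]

theorem swap_notMem_of_isBoundaryPart {F : Set ℂ} {S : Multiset (ℂ × ℂ)} (hF : G.IsCell F)
    (hS : G.IsBoundaryPart F S) {s : ℂ × ℂ} (hs : s ∈ S) : s.1 ≠ s.2 ∧ s.swap ∉ S :=
  ⟨(hS.adj s hs).ne, fun h => hF.not_both _ _ (hS.adj s hs) (hS.leftOf s hs) (hS.leftOf _ h)⟩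

theorem IsBoundaryPart.of_le {F : Set ℂ} {S T : Multiset (ℂ × ℂ)} (hS : G.IsBoundaryPart F S)
    (hle : T ≤ S) (hT : Balanced T) : G.IsBoundaryPart F T where
  nodup := Multiset.nodup_of_le hle hS.nodup
  balanced := hT
  adj s hs := hS.adj s (Multiset.mem_of_le hle hs)
  leftOf s hs := hS.leftOf s (Multiset.mem_of_le hle hs)

theorem three_le_length_of_isBoundaryPart {F : Set ℂ} (hF : G.IsCell F) {c : Ring}
    (hc : c.Closed) (hne : c ≠ Cycle.nil) (hS : G.IsBoundaryPart F c.toMultiset) :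
    3 ≤ c.length :=
  Ring.three_le_length hc hne fun s hs => by
    simpa only [Ring.mem_toMultiset] using
      swap_notMem_of_isBoundaryPart hF hS (Ring.mem_toMultiset.2 hs)

theorem toMultiset_le_sides {P : LabelledPolygon C} {r : Ring} (hr : r ∈ P.rings) :
    r.toMultiset ≤ P.sides :=
  Finset.single_le_sum (f := fun r : Ring => r.toMultiset) (fun _ _ => zero_le) hr

/-- However the traced rings are cut into simple ones, each piece is an outer ring around the face
or the ring of a hole, and as the total winding number in the face is `1`, exactly one piece is an
outer ring. -/
theorem exists_outer_holes {F : G.Face Ω} (hF : G.IsCell F.1)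
    (hdeg : ∀ v ∈ G.verts, ∃ w, G.graph.Adj v w) :
    ∃ (parts : Ring → Multiset Ring) (outer : Ring) (holes : Multiset Ring),
      (∀ r ∈ (F.traced M).rings, ((parts r).map Cycle.toMultiset).sum = r.toMultiset) ∧
      ∑ r ∈ (F.traced M).rings, parts r = outer ::ₘ holes ∧
      Ring.IsOuter outer ∧ ∀ h ∈ holes, Ring.IsHole h := by
  have hP := isBoundaryPart_traced (M := M) hF
  have hex : ∀ r : Ring, ∃ parts : Multiset Ring, r ∈ (F.traced M).rings →
      (parts.map Cycle.toMultiset).sum = r.toMultiset ∧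
        ∀ c ∈ parts, c.Closed ∧ c ≠ Cycle.nil ∧ (c.map Prod.fst).Nodup := by
    intro r
    by_cases hr : r ∈ (F.traced M).rings
    · obtain ⟨parts, h⟩ := r.exists_parts (closed_of_mem_rings hr)
      exact ⟨parts, fun _ => h⟩
    · exact ⟨0, fun h => absurd h hr⟩
  choose parts hparts using hex
  obtain ⟨p, hp⟩ := F.nonempty
  have hpb : p ∉ (F.traced M).boundary := hP.notMem_carrier hF.toIsRegion hp
  have hT : ∀ c ∈ ∑ r ∈ (F.traced M).rings, parts r,
      (c.IsOuter ∧ c.winding p = 1) ∨ (c.IsHole ∧ c.winding p = 0) := by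
    intro c hc
    obtain ⟨r, hr, hcr⟩ := Multiset.mem_sum.1 hc
    obtain ⟨hsum, hpr⟩ := hparts r hr
    obtain ⟨hcl, hne, hnd⟩ := hpr c hcr
    have hle : c.toMultiset ≤ (F.traced M).sides := by
      refine le_trans ?_ (toMultiset_le_sides hr)
      rw [← hsum]
      exact Multiset.single_le_sum (fun _ _ => zero_le) _ (Multiset.mem_map_of_mem _ hcr)
    have hcS := hP.of_le hle (Ring.balanced_of_closed hcl)
    refine hcS.isOuter_or_isHole hF ⟨hcl, ?_, hnd, fun s hs t ht => ?_⟩ hp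
    · exact three_le_length_of_isBoundaryPart hF hcl hne hcS
    · exact properlyMeet (hcS.adj s (Ring.mem_toMultiset.2 hs))
        (hcS.adj t (Ring.mem_toMultiset.2 ht))
  have hsum : ((∑ r ∈ (F.traced M).rings, parts r).map fun c => c.winding p).sum = 1 := by
    rw [← (winding_traced hF hdeg hpb).1 hp, LabelledPolygon.winding,
      show ((∑ r ∈ (F.traced M).rings, parts r).map fun c => c.winding p)
        = ∑ r ∈ (F.traced M).rings, (parts r).map fun c => c.winding p from
        map_sum (Multiset.mapAddMonoidHom fun c : Ring => c.winding p) _ _]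
    rw [show (∑ r ∈ (F.traced M).rings, (parts r).map fun c => c.winding p).sum
        = ∑ r ∈ (F.traced M).rings, ((parts r).map fun c => c.winding p).sum from
        map_sum (Multiset.sumAddMonoidHom) _ _]
    refine Finset.sum_congr rfl fun r hr => ?_
    rw [Ring.winding_eq, ← (hparts r hr).1, totalAng_multiset_sum, Multiset.map_map,
      ← Multiset.sum_map_div]
    rfl
  obtain ⟨outer, holes, h1, h2, h3⟩ := Ring.exists_unique_outer _ _ hT hsum
  exact ⟨parts, outer, holes, fun r hr => (hparts r hr).1, h1, h2, h3⟩

theorem traced_valid {F : G.Face Ω} (hF : G.IsCell F.1)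
    (hdeg : ∀ v ∈ G.verts, ∃ w, G.graph.Adj v w) : (F.traced M).Valid := by
  have hP := isBoundaryPart_traced (M := M) hF
  have hin := inside_traced (M := M) hF hdeg
  exact
    { closed := fun r hr => by
        refine ⟨closed_of_mem_rings hr, three_le_length_of_isBoundaryPart hF
          (closed_of_mem_rings hr) ?_ (hP.of_le (toMultiset_le_sides hr)
          (Ring.balanced_of_closed (closed_of_mem_rings hr)))⟩
        rintro rfl
        obtain ⟨d, -, hd⟩ := mem_rings_traced.1 hr
        exact Cycle.notMem_nil _ (hd ▸ self_mem_tracedRing d)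
      nodup := hP.nodup
      not_both := fun s hs => swap_notMem_of_isBoundaryPart hF hP hs
      proper := fun s hs t ht => properlyMeet (hP.adj s hs) (hP.adj t ht)
      outer_holes := exists_outer_holes hF hdeg
      winding_eq := fun p hp => by
        by_cases hpF : p ∈ F.1
        · exact .inr ((winding_traced hF hdeg hp).1 hpF)
        · exact .inl ((winding_traced hF hdeg hp).2 hpF)
      isOpen := hin ▸ hF.isOpen
      connected := hin ▸ hF.isConnected
      bounded := hin ▸ hF.isBounded
      frontier_eq := by rw [hin, boundary_traced hF hdeg] }

end PSLG

/-! ### Faces -/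

namespace PSLG

variable {G : PSLG} {Ω : Set ℂ}

theorem Face.subset (F : G.Face Ω) : F.1 ⊆ Ω \ G.support := by
  obtain ⟨x, -, h⟩ := F.2
  exact h ▸ connectedComponentIn_subset _ _

theorem Face.isConnected (F : G.Face Ω) : IsConnected F.1 := by
  obtain ⟨x, hx, h⟩ := F.2
  exact h ▸ isConnected_connectedComponentIn_iff.2 hx

theorem exists_face {x : ℂ} (hx : x ∈ Ω \ G.support) : ∃ F : G.Face Ω, x ∈ F.1 :=
  ⟨⟨_, x, hx, rfl⟩, mem_connectedComponentIn hx⟩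

theorem Face.eq_of_mem {F F' : G.Face Ω} {z : ℂ} (h : z ∈ F.1) (h' : z ∈ F'.1) : F = F' := by
  obtain ⟨x, -, hx⟩ := F.2
  obtain ⟨x', -, hx'⟩ := F'.2
  rw [hx] at h
  rw [hx'] at h'
  exact Subtype.ext (by rw [hx, hx', connectedComponentIn_eq h, connectedComponentIn_eq h'])

theorem isOpen_diff_support (hΩ : IsClosed Ω) (hbd : frontier Ω ⊆ G.support) :
    IsOpen (Ω \ G.support) := by
  have : Ω \ G.support = interior Ω \ G.support := by
    ext z
    refine ⟨fun hz => ⟨?_, hz.2⟩, fun hz => ⟨interior_subset hz.1, hz.2⟩⟩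
    by_contra h
    exact hz.2 (hbd (hΩ.frontier_eq ▸ ⟨hz.1, h⟩))
  rw [this]
  exact isOpen_interior.sdiff isClosed_support

theorem Face.isRegion (hΩ : IsClosed Ω) (hbd : frontier Ω ⊆ G.support) (F : G.Face Ω) :
    G.IsRegion F.1 := by
  have hopen : ∀ F : G.Face Ω, IsOpen F.1 := by
    rintro ⟨_, x, -, rfl⟩
    exact (isOpen_diff_support hΩ hbd).connectedComponentIn
  refine ⟨hopen F, fun z hz => (F.subset hz).2, fun z hz => ?_⟩
  by_contra hn
  have hzΩ : z ∈ Ω := closure_minimal (fun y hy => (F.subset hy).1) hΩ (frontier_subset_closure hz)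
  obtain ⟨F', hF'⟩ := exists_face ⟨hzΩ, hn⟩
  obtain ⟨y, hy, hy'⟩ := ((mem_closure_iff_frequently.1
    (frontier_subset_closure hz)).and_eventually ((hopen F').mem_nhds hF')).exists
  rw [← Face.eq_of_mem hy hy'] at hF'
  exact hz.2 ((hopen F).interior_eq.symm ▸ hF')

/-- If points of the domain occur arbitrarily close to the left of an edge, then a face lies
there. -/
theorem exists_face_leftOf (hΩ : IsClosed Ω) (hbd : frontier Ω ⊆ G.support) {u v p : ℂ}
    (h : G.graph.Adj u v) (hp : p ∈ openSegment ℝ u v)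
    (hfr : ∃ᶠ z in 𝓝 p, 0 < side u v z ∧ z ∈ Ω) : ∃ F : G.Face Ω, LeftOf F.1 u v := by
  obtain ⟨T, -, hT, hd, -, hev⟩ := exists_halfDisc h hp univ_mem
  obtain ⟨x, ⟨hx, hxΩ⟩, hxT⟩ := (hfr.and_eventually hev).exists
  obtain ⟨F, hF⟩ := exists_face (G := G) ⟨hxΩ, hd x (hxT hx)⟩
  have hTF := (F.isRegion hΩ hbd).subset_of_isPreconnected hT hd ⟨x, hxT hx, hF⟩
  exact ⟨F, (F.isRegion hΩ hbd).leftOf_of_frequently h hp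
    (((frequently_side_pos h.ne hp).and_eventually hev).mono fun z hz =>
      ⟨hz.1, hTF (hz.2 hz.1)⟩)⟩

theorem Face.eq_of_leftOf {F F' : G.Face Ω} {u v : ℂ} (huv : u ≠ v) (h : LeftOf F.1 u v)
    (h' : LeftOf F'.1 u v) : F = F' := by
  have hp : u + ((1 / 2 : ℝ) : ℂ) * (v - u) ∈ openSegment ℝ u v :=
    mem_openSegment_iff.2 ⟨1 / 2, by norm_num, by norm_num, rfl⟩
  obtain ⟨z, hz, h1, h2⟩ := ((frequently_side_pos huv hp).and_eventually
    ((h _ hp).and (h' _ hp))).exists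
  exact Face.eq_of_mem (h1 hz) (h2 hz)

theorem finite_face (hcell : ∀ F : G.Face Ω, G.IsCell F.1)
    (hdeg : ∀ v ∈ G.verts, ∃ w, G.graph.Adj v w) : Finite (G.Face Ω) := by
  have hex : ∀ F : G.Face Ω, ∃ d : G.graph.Dart, LeftOf F.1 d.fst d.snd := by
    intro F
    have hne : (frontier F.1).Nonempty := nonempty_frontier_iff.2 ⟨F.nonempty, fun h =>
      NoncompactSpace.noncompact_univ (X := ℂ)
        (by
          have := (hcell F).isBounded.isCompact_closure
          rwa [h, closure_univ] at this)⟩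
    rw [(hcell F).frontier_eq hdeg] at hne
    obtain ⟨p, hp⟩ := hne
    simp only [mem_iUnion, exists_prop] at hp
    obtain ⟨d, hd, -⟩ := hp
    exact ⟨d, hd⟩
  choose f hf using hex
  exact Finite.of_injective f fun F F' h => Face.eq_of_leftOf (f F).adj.ne (hf F) (h ▸ hf F')

theorem Face.label_eq {C : Type*} {M : ℂ → C}
    (htrans : transitionSet Ω M ⊆ G.support) (F : G.Face Ω) {p : ℂ} (hp : p ∈ F.1) :
    M p = F.label M := by
  refine F.isConnected.isPreconnected.induction₂ (fun x y => M x = M y) (fun x hx => ?_)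
    (fun x y z _ _ _ h h' => h.trans h') (fun x y _ _ h => h.symm) hp F.nonempty.some_mem
  have hx' : x ∉ transitionSet Ω M := fun h => (F.subset hx).2 (htrans h)
  have hxΩ := (F.subset hx).1
  simp only [transitionSet, mem_ofPred_eq, not_and, not_forall, not_exists, not_not] at hx'
  obtain ⟨U, hU, h⟩ := hx' hxΩ
  filter_upwards [mem_nhdsWithin_of_mem_nhds hU, self_mem_nhdsWithin] with y hy hyF
  exact h x ⟨mem_of_mem_nhds hU, hxΩ⟩ y ⟨hy, (F.subset hyF).1⟩

end PSLG

/-! ### The rectangle -/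

theorem imageDomain_eq (W H : ℝ) :
    imageDomain W H = {z | 0 ≤ z.re ∧ z.re ≤ W ∧ 0 ≤ z.im ∧ z.im ≤ H} := by
  ext z
  simp [imageDomain, Complex.mem_reProdIm, and_assoc]

theorem isClosed_imageDomain (W H : ℝ) : IsClosed (imageDomain W H) :=
  isClosed_Icc.reProdIm isClosed_Icc

theorem isBounded_imageDomain (W H : ℝ) : Bornology.IsBounded (imageDomain W H) :=
  (Metric.isBounded_Icc _ _).reProdIm (Metric.isBounded_Icc _ _)

theorem closure_interior_imageDomain {W H : ℝ} (hW : 0 < W) (hH : 0 < H) :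
    closure (interior (imageDomain W H)) = imageDomain W H := by
  rw [imageDomain, Complex.interior_reProdIm, Complex.closure_reProdIm, interior_Icc, interior_Icc,
    closure_Ioo hW.ne, closure_Ioo hH.ne]

/-- A half-plane with a segment on its bounding line lies on one side of the segment. -/
theorem exists_halfPlane_side {n u v : ℂ} {c : ℝ} (hn : n ≠ 0) (huv : u ≠ v)
    (hu : (n * u).re + c = 0) (hv : (n * v).re + c = 0) :
    ∃ κ : ℝ, κ ≠ 0 ∧ ∀ z, (n * z).re + c = κ * side u v z := by
  have h1 : v - u ≠ 0 := sub_ne_zero.2 huv.symm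
  have hre : (n * (v - u)).re = 0 := by
    rw [mul_sub, Complex.sub_re]
    linarith
  refine ⟨-(n * (v - u)).im, ?_, fun z => ?_⟩
  · rw [neg_ne_zero]
    intro him
    exact mul_ne_zero hn h1 (Complex.ext hre him)
  · have hz : n * z = n * u + n * (v - u) * ((z - u) / (v - u)) := by
      field_simp
      ring
    rw [hz, Complex.add_re, Complex.mul_re (n * (v - u)), hre, side]
    linarith

/-- A segment in the rectangle either passes through the interior, or lies on the boundary, in which
case the rectangle is on one side of it. -/
theorem segment_dichotomy {W H : ℝ} {u v : ℂ} (huv : u ≠ v) (hu : u ∈ imageDomain W H)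
    (hv : v ∈ imageDomain W H) :
    (∃ p ∈ openSegment ℝ u v, p ∈ interior (imageDomain W H)) ∨
      (segment ℝ u v ⊆ frontier (imageDomain W H) ∧
        ∃ κ : ℝ, κ ≠ 0 ∧ ∀ z ∈ imageDomain W H, 0 ≤ κ * side u v z) := by
  -- the four half-planes that cut out the rectangle
  have key : ∀ (n : ℂ) (c : ℝ), n ≠ 0 → (∀ z ∈ imageDomain W H, 0 ≤ (n * z).re + c) →
      (n * ((u + v) / 2)).re + c ≤ 0 → (segment ℝ u v ⊆ frontier (imageDomain W H) ∧
        ∃ κ : ℝ, κ ≠ 0 ∧ ∀ z ∈ imageDomain W H, 0 ≤ κ * side u v z) := by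
    intro n c hn hpos hm
    have e : (n * ((u + v) / 2)).re + c = (((n * u).re + c) + ((n * v).re + c)) / 2 := by
      rw [show n * ((u + v) / 2) = ((1 / 2 : ℝ) : ℂ) * (n * u + n * v) by push_cast; ring,
        Complex.re_ofReal_mul, Complex.add_re]
      ring
    have hu0 := hpos u hu
    have hv0 := hpos v hv
    have hu1 : (n * u).re + c = 0 := by linarith
    have hv1 : (n * v).re + c = 0 := by linarith
    obtain ⟨κ, hκ, hside⟩ := exists_halfPlane_side hn huv hu1 hv1
    refine ⟨fun z hz => ?_, κ, hκ, fun z hz => hside z ▸ hpos z hz⟩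
    have hconv : Convex ℝ (imageDomain W H) := ((convex_Icc 0 W).linear_preimage Complex.reLm).inter
      ((convex_Icc 0 H).linear_preimage Complex.imLm)
    rw [(isClosed_imageDomain W H).frontier_eq]
    refine ⟨hconv.segment_subset hu hv hz, fun hint => ?_⟩
    have hz0 : (n * z).re + c = 0 := by
      obtain ⟨a, b, -, -, hab, rfl⟩ := hz
      rw [show n * (a • u + b • v) = (a : ℂ) * (n * u) + (b : ℂ) * (n * v) by
        simp only [Complex.real_smul]; ring, Complex.add_re, Complex.re_ofReal_mul,
        Complex.re_ofReal_mul]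
      linear_combination a * hu1 + b * hv1 - c * hab
    -- moving from `z` against the normal direction leaves the half-plane
    have htend : Tendsto (fun t : ℝ => z - t * conj n) (𝓝[>] 0) (𝓝 z) := by
      have : Continuous fun t : ℝ => z - t * conj n := by fun_prop
      simpa using (this.tendsto 0).mono_left nhdsWithin_le_nhds
    obtain ⟨t, ht, ht0⟩ := ((htend.eventually (mem_interior_iff_mem_nhds.1 hint)).and
      self_mem_nhdsWithin).exists
    have h1 := hpos _ ht
    have h2 : n * (z - t * conj n) = n * z - ((t * Complex.normSq n : ℝ) : ℂ) := by
      push_cast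
      rw [← Complex.mul_conj]
      ring
    rw [h2, Complex.sub_re, Complex.ofReal_re] at h1
    have h3 : 0 < t * Complex.normSq n := mul_pos ht0 (Complex.normSq_pos.2 hn)
    linarith
  by_contra hcon
  rw [not_or] at hcon
  obtain ⟨hcon, hcon'⟩ := hcon
  have hkey := fun n c hn hpos => lt_of_not_ge fun hm => hcon' (key n c hn hpos hm)
  have h1 := hkey 1 0 one_ne_zero fun z hz => by
    rw [imageDomain_eq] at hz; simpa using hz.1
  have h2 := hkey (-1) W (by simp) fun z hz => by
    rw [imageDomain_eq] at hz; simpa using hz.2.1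
  have h3 := hkey (-Complex.I) 0 (by simp) fun z hz => by
    rw [imageDomain_eq] at hz; simpa using hz.2.2.1
  have h4 := hkey Complex.I H (by simp) fun z hz => by
    rw [imageDomain_eq] at hz; simpa using hz.2.2.2
  refine hcon ⟨(u + v) / 2, mem_openSegment_iff.2 ⟨1 / 2, by norm_num, by norm_num, ?_⟩, ?_⟩
  · push_cast
    ring
  · rw [imageDomain, Complex.interior_reProdIm, interior_Icc, interior_Icc, Complex.mem_reProdIm]
    generalize (u + v) / 2 = m at *
    refine ⟨⟨?_, ?_⟩, ?_, ?_⟩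
    · simpa using h1
    · simpa using h2
    · simpa using h3
    · simpa using h4

/-! ### Faces in the rectangle -/

namespace PSLG

variable {C : Type*} {W H : ℝ} {M : ℂ → C} {G : PSLG}

/-- On an edge in the boundary of the rectangle, only one of the sides can carry a face. -/
theorem not_leftOf_swap_of_halfPlane {F F' : G.Face (imageDomain W H)} {u v : ℂ} (huv : u ≠ v)
    {κ : ℝ} (hκ : κ ≠ 0) (hside : ∀ z ∈ imageDomain W H, 0 ≤ κ * side u v z)
    (h : LeftOf F.1 u v) : ¬ LeftOf F'.1 v u := by
  intro h'
  have hp : u + ((1 / 2 : ℝ) : ℂ) * (v - u) ∈ openSegment ℝ u v :=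
    mem_openSegment_iff.2 ⟨1 / 2, by norm_num, by norm_num, rfl⟩
  have hp' := openSegment_symm ℝ u v ▸ hp
  obtain ⟨z, hz, h1⟩ := ((frequently_side_pos huv hp).and_eventually (h _ hp)).exists
  obtain ⟨z', hz', h1'⟩ := ((frequently_side_pos huv.symm hp').and_eventually (h' _ hp')).exists
  have h2 := hside z (F.subset (h1 hz)).1
  have h2' := hside z' (F'.subset (h1' hz')).1
  rw [side_swap huv] at hz'
  rcases lt_or_gt_of_ne hκ with hneg | hpos
  · nlinarith
  · nlinarith

theorem exists_face_of_interior (hbd : frontier (imageDomain W H) ⊆ G.support) {u v p : ℂ}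
    (h : G.graph.Adj u v) (hp : p ∈ openSegment ℝ u v) (hint : p ∈ interior (imageDomain W H)) :
    ∃ F : G.Face (imageDomain W H), LeftOf F.1 u v :=
  exists_face_leftOf (isClosed_imageDomain W H) hbd h hp
    ((frequently_side_pos h.ne hp).and_eventually (mem_interior_iff_mem_nhds.1 hint))

/-- Every edge has a face on at least one side. -/
theorem exists_face_side (hW : 0 < W) (hH : 0 < H)
    (hG : (G.verts : Set ℂ) ⊆ imageDomain W H)
    (hbd : frontier (imageDomain W H) ⊆ G.support) {u v : ℂ} (h : G.graph.Adj u v) :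
    ∃ F : G.Face (imageDomain W H), LeftOf F.1 u v ∨ LeftOf F.1 v u := by
  rcases segment_dichotomy h.ne (hG (G.mem_verts _ _ h)) (hG (G.mem_verts _ _ h.symm)) with
    ⟨p, hp, hint⟩ | ⟨hfr, -⟩
  · obtain ⟨F, hF⟩ := exists_face_of_interior hbd h hp hint
    exact ⟨F, .inl hF⟩
  · have hp : u + ((1 / 2 : ℝ) : ℂ) * (v - u) ∈ openSegment ℝ u v :=
      mem_openSegment_iff.2 ⟨1 / 2, by norm_num, by norm_num, rfl⟩
    set p := u + ((1 / 2 : ℝ) : ℂ) * (v - u)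
    have hpΩ : p ∈ closure (interior (imageDomain W H)) := by
      rw [closure_interior_imageDomain hW hH]
      exact (isClosed_imageDomain W H).frontier_subset (hfr (openSegment_subset_segment ℝ _ _ hp))
    have hev : ∃ᶠ z in 𝓝 p, (0 < side u v z ∧ z ∈ imageDomain W H) ∨
        (0 < side v u z ∧ z ∈ imageDomain W H) := by
      refine ((mem_closure_iff_frequently.1 hpΩ).and_eventually
        (eventually_mem_openSegment h.ne hp)).mono fun z ⟨hz, hz0⟩ => ?_
      rw [side_swap h.ne]
      rcases lt_trichotomy (side u v z) 0 with hs | hs | hs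
      · exact .inr ⟨by linarith, interior_subset hz⟩
      · exact absurd hz (hfr (openSegment_subset_segment ℝ _ _ (hz0 hs))).2
      · exact .inl ⟨hs, interior_subset hz⟩
    rcases frequently_or_distrib.1 hev with hev | hev
    · obtain ⟨F, hF⟩ := exists_face_leftOf (isClosed_imageDomain W H) hbd h hp hev
      exact ⟨F, .inl hF⟩
    · obtain ⟨F, hF⟩ := exists_face_leftOf (isClosed_imageDomain W H) hbd h.symm
        (openSegment_symm ℝ u v ▸ hp) hev
      exact ⟨F, .inr hF⟩

theorem label_ne (hbd : frontier (imageDomain W H) ⊆ G.support)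
    (hi : EdgesSeparateLabels G (imageDomain W H) M) {F F' : G.Face (imageDomain W H)} {u v : ℂ}
    (h : G.graph.Adj u v) (hseg : ¬ segment ℝ u v ⊆ frontier (imageDomain W H))
    (hF : LeftOf F.1 u v) (hF' : LeftOf F'.1 v u) : F.label M ≠ F'.label M :=
  (hi u v h hseg).2 F F'
    ((Face.isLeftOf_iff (F.isRegion (isClosed_imageDomain W H) hbd) h).2 hF)
    ((Face.isLeftOf_iff (F'.isRegion (isClosed_imageDomain W H) hbd) h.symm).2 hF')

/-- Every face is a cell: an edge with the same face on both sides could neither lie on the boundary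
of the rectangle nor separate two labels. -/
theorem isCell_face (hG : (G.verts : Set ℂ) ⊆ imageDomain W H)
    (hbd : frontier (imageDomain W H) ⊆ G.support)
    (hi : EdgesSeparateLabels G (imageDomain W H) M) (F : G.Face (imageDomain W H)) :
    G.IsCell F.1 where
  toIsRegion := F.isRegion (isClosed_imageDomain W H) hbd
  isConnected := F.isConnected
  isBounded := (isBounded_imageDomain W H).subset fun _ hz => (F.subset hz).1
  not_both u v h hl hr := by
    rcases segment_dichotomy h.ne (hG (G.mem_verts _ _ h)) (hG (G.mem_verts _ _ h.symm)) with
      ⟨p, hp, hint⟩ | ⟨-, κ, hκ, hside⟩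
    · exact label_ne hbd hi h
        (fun hs => (hs (openSegment_subset_segment ℝ _ _ hp)).2 hint) hl hr rfl
    · exact not_leftOf_swap_of_halfPlane h.ne hκ hside hl hr

theorem exists_adj_of_keypoints (hii : VertsAreKeypoints G) {v : ℂ} (hv : v ∈ G.verts) :
    ∃ w, G.graph.Adj v w := by
  have : (G.graph.neighborSet v).Nonempty := by
    rw [nonempty_iff_ne_empty]
    intro h
    rcases hii v hv with hJ | ⟨a, b, -, hN, -⟩ | hE
    · rw [IsJunction, h, ncard_empty] at hJ
      omega
    · rw [h] at hN
      exact absurd (hN ▸ mem_insert a {b}) (notMem_empty a)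
    · rw [IsEndpoint, h, ncard_empty] at hE
      omega
  exact this

theorem region_traced {Ω : Set ℂ} {F : G.Face Ω} (hF : G.IsCell F.1)
    (hdeg : ∀ v ∈ G.verts, ∃ w, G.graph.Adj v w) : (F.traced M).region = closure F.1 := by
  rw [LabelledPolygon.region, boundary_traced hF hdeg, inside_traced hF hdeg, union_comm,
    closure_eq_self_union_frontier]

/-- At the start of a side of a polygon at least two edges meet: the ring arrives there along an
edge, which is not the same side in the opposite direction. -/
theorem not_isEndpoint {F : Set ℂ} {S : Multiset (ℂ × ℂ)} (hF : G.IsCell F)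
    (hS : G.IsBoundaryPart F S) {s : ℂ × ℂ} (hs : s ∈ S) :
    ¬ IsEndpoint s.1 (G.graph.neighborSet s.1) := by
  intro hE
  have hmem : s.1 ∈ S.map Prod.snd := by
    rw [← show S.map Prod.fst = S.map Prod.snd from hS.balanced]
    exact Multiset.mem_map_of_mem _ hs
  obtain ⟨t, ht, hts⟩ := Multiset.mem_map.1 hmem
  obtain ⟨a, ha⟩ := ncard_eq_one.1 hE
  have h1 : s.2 = a := by
    have : s.2 ∈ G.graph.neighborSet s.1 := hS.adj s hs
    rwa [ha] at this
  have h2 : t.1 = a := by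
    have : t.1 ∈ G.graph.neighborSet s.1 := hts ▸ (hS.adj t ht).symm
    rwa [ha] at this
  refine (swap_notMem_of_isBoundaryPart hF hS hs).2 ?_
  rwa [show s.swap = t from Prod.ext (h1.trans h2.symm) hts.symm]

theorem disjoint_interior_closure {A B : Set ℂ} (hA : IsOpen A)
    (h : Disjoint A B) : Disjoint (interior (closure A)) (interior (closure B)) := by
  have h1 : Disjoint A (closure B) := h.closure_right hA
  have h2 : Disjoint A (interior (closure B)) := h1.mono_right interior_subset
  exact (h2.closure_left isOpen_interior).mono_left interior_subset

theorem exists_mem_sides_iff (hW : 0 < W) (hH : 0 < H) (hG : (G.verts : Set ℂ) ⊆ imageDomain W H)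
    (hbd : frontier (imageDomain W H) ⊆ G.support) (u v : ℂ) :
    G.graph.Adj u v ↔ ∃ F : G.Face (imageDomain W H),
      (u, v) ∈ (F.traced M).sides ∨ (v, u) ∈ (F.traced M).sides := by
  have hmem := fun (F : G.Face (imageDomain W H)) (s : ℂ × ℂ) =>
    mem_sides_traced (M := M) (s := s) (F.isRegion (isClosed_imageDomain W H) hbd)
  constructor
  · intro h
    obtain ⟨F, hF⟩ := exists_face_side hW hH hG hbd h
    exact ⟨F, hF.imp (fun hl => (hmem F _).2 ⟨h, hl⟩) fun hl => (hmem F _).2 ⟨h.symm, hl⟩⟩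
  · rintro ⟨F, h | h⟩
    · exact ((hmem F _).1 h).1
    · exact ((hmem F _).1 h).1.symm

end PSLG

end ACPV

theorem proposition1 {C : Type*} (W H : ℝ) (hW : 0 < W) (hH : 0 < H) (M : ℂ → C) (G : ACPV.PSLG)
    (hG : (G.verts : Set ℂ) ⊆ ACPV.imageDomain W H)
    (hbd : frontier (ACPV.imageDomain W H) ⊆ G.support)
    (htrans : ACPV.transitionSet (ACPV.imageDomain W H) M ⊆ G.support)
    (hi : ACPV.EdgesSeparateLabels G (ACPV.imageDomain W H) M)
    (hii : ACPV.VertsAreKeypoints G) :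
    -- the polygons traced along the face boundaries satisfy the constraints (a)-(f)
    ACPV.IsPartition (ACPV.imageDomain W H) M
        (fun F : G.Face (ACPV.imageDomain W H) => F.traced M) ∧
      -- the polygon traced for a face encloses exactly this face
      (∀ F : G.Face (ACPV.imageDomain W H), (F.traced M).inside = F.1) ∧
      -- and the sides of the polygons are exactly the edges of the graph
      (∀ u v, G.graph.Adj u v ↔ ∃ F : G.Face (ACPV.imageDomain W H),
        (u, v) ∈ (F.traced M).sides ∨ (v, u) ∈ (F.traced M).sides) := by
  open ACPV ACPV.PSLG in
  have hΩ := isClosed_imageDomain W H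
  have hcell := isCell_face hG hbd hi
  have hdeg : ∀ v ∈ G.verts, ∃ w, G.graph.Adj v w := fun v hv => exists_adj_of_keypoints hii hv
  have hin := fun F => inside_traced (M := M) (hcell F) hdeg
  have hreg := fun F => region_traced (M := M) (hcell F) hdeg
  have hpart := fun F => isBoundaryPart_traced (M := M) (hcell F)
  have hmem := fun (F : G.Face (imageDomain W H)) (s : ℂ × ℂ) =>
    mem_sides_traced (M := M) (s := s) (hcell F).toIsRegion
  have hsides := exists_mem_sides_iff (M := M) hW hH hG hbd
  have hdich := fun {u v : ℂ} (h : G.graph.Adj u v) =>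
    segment_dichotomy h.ne (hG (G.mem_verts _ _ h)) (hG (G.mem_verts _ _ h.symm))
  refine ⟨⟨⟨finite_face hcell hdeg, fun F => traced_valid (hcell F) hdeg⟩, ?_, ?_, ?_,
    ⟨?_, ?_, ?_, ?_⟩, ?_⟩, hin, hsides⟩
  · refine Set.Subset.antisymm (Set.iUnion_subset fun F => ?_) fun p hp => ?_
    · rw [hreg]
      exact closure_minimal (fun z hz => (F.subset hz).1) hΩ
    · -- an edge through `p`, if `p` lies on the graph
      have hedge : p ∈ G.support → ∃ u v, G.graph.Adj u v ∧ p ∈ segment ℝ u v := by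
        intro hp
        rcases mem_support.1 hp with hv | h
        · obtain ⟨w, hw⟩ := hdeg p hv
          exact ⟨p, w, hw, left_mem_segment ℝ _ _⟩
        · exact h
      rw [Set.mem_iUnion]
      by_cases hps : p ∈ G.support
      · obtain ⟨u, v, h, hpuv⟩ := hedge hps
        obtain ⟨F, hF⟩ := (hsides u v).1 h
        refine ⟨F, .inl (mem_carrier.2 ?_)⟩
        rcases hF with hF | hF
        · exact ⟨_, hF, hpuv⟩
        · exact ⟨_, hF, segment_symm ℝ u v ▸ hpuv⟩
      · obtain ⟨F, hF⟩ := exists_face (G := G) ⟨hp, hps⟩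
        exact ⟨F, .inr ((hin F).symm ▸ hF)⟩
  · intro F F' hne
    simp only [hreg]
    refine disjoint_interior_closure (hcell F).isOpen ?_
    exact Set.disjoint_left.2 fun z hz hz' => hne (Face.eq_of_mem hz hz')
  · intro F p hp
    exact F.label_eq htrans (hin F ▸ hp)
  · exact fun F F' s hs t ht => properlyMeet ((hpart F).adj s hs) ((hpart F').adj t ht)
  · exact fun F F' hne s hs hs' => hne (Face.eq_of_leftOf ((hpart F).adj s hs).ne
      ((hpart F).leftOf s hs) ((hpart F').leftOf s hs'))
  · intro F s hs hseg F' hs'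
    have h := (hpart F).adj s hs
    rcases hdich h with ⟨p, hp, hint⟩ | ⟨-, κ, hκ, hside⟩
    · exact (hseg (openSegment_subset_segment ℝ _ _ hp)).2 hint
    · exact not_leftOf_swap_of_halfPlane h.ne hκ hside ((hpart F).leftOf s hs)
        ((hpart F').leftOf _ hs')
  · intro F s hs hseg
    have h := (hpart F).adj s hs
    rcases hdich h with ⟨p, hp, hint⟩ | ⟨hfr, -⟩
    · obtain ⟨F', hF'⟩ := exists_face_of_interior hbd h.symm (openSegment_symm ℝ s.1 s.2 ▸ hp) hint
      have hlab := label_ne hbd hi h hseg ((hpart F).leftOf s hs) hF'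
      refine ⟨F', ?_, (hmem F' s.swap).2 ⟨h.symm, hF'⟩, hlab.symm, fun F'' hF'' => ?_⟩
      · rintro rfl
        exact hlab rfl
      · exact Face.eq_of_leftOf h.symm.ne ((hpart F'').leftOf _ hF'') hF'
    · exact absurd hfr hseg
  · intro F s hs
    have hN : {w | ∃ F : G.Face (imageDomain W H), (s.1, w) ∈ (F.traced M).sides ∨
        (w, s.1) ∈ (F.traced M).sides} = G.graph.neighborSet s.1 := by
      ext w
      exact (hsides s.1 w).symm
    rw [hN]
    rcases hii s.1 (G.mem_verts _ _ ((hpart F).adj s hs)) with h | h | h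
    · exact .inl h
    · exact .inr h
    · exact absurd h (not_isEndpoint (hcell F) (hpart F) hs)
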